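/- Work over $\mathbb{Q}$. For a graded finite-dimensional $\Sigma_n$-representation $V=\bigoplus_{d\ge 0}V_d$ put $$Z_V(q;p_1,p_2,\dots)=\frac1{n!}\sum_{\sigma\in\Sigma_n}\Big(\sum_{d\ge 0}\operatorname{tr}(\sigma|V_d)\,q^d\Big)\prod_{j\ge1}p_j^{\ell_j(\sigma)},$$ where $\ell_j(\sigma)$ is the number of cycles of length $j$ of $\sigma$, and for a symmetric sequence $M=\{M(n)\}_{n\ge0}$ of such representations put $Z_M=\sum_{n\ge0}Z_{M(n)}\in\mathbb{Q}[q][[p_1,p_2,\dots]]$. Give $p_i$ cardinality degree $i$, and let $(f)_{\le N}$ denote the sum of the terms of $f$ of cardinality degree at most $N$. For $k\ge 2$ let $\mathcal{H}_1^{(k)}$ be the symmetric sequence with $\mathcal{H}_1^{(k)}(n)=0$ for $n<k$ and $\mathcal{H}_1^{(k)}(n)=s^{k-2}V_{(n-k+1,1^{k-1})}$ for $n\ge k$, where $V_\lambda$ is the irreducible representation of $\Sigma_n$ corresponding to the partition $\lambda$ of $n$ (the Specht module) and $s^{k-2}$ places it in degree $k-2$. Then $$Z_{\mathcal{H}_1^{(k)}}(q;p_1,p_2,\dots)=(-q)^{k-2}-(-q)^{k-2}\left(\exp\Big(-\sum_{i\ge1}\frac{p_i}{i}\Big)\right)_{\le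 k-1}\exp\Big(\sum_{i\ge1}\frac{p_i}{i}\Big).$$ -/

import Mathlib

noncomputable section

open Equiv

/-! ## Specht modules over `ℚ` -/

/-- A (bijective) Young tableau of shape `μ`: the cells of `μ` are filled with the elements of
`Fin n`, each used exactly once. A cell is a pair `(row, column)`. If `μ` does not have exactly
`n` cells, there is no such tableau. -/
def Tableau (μ : YoungDiagram) (n : ℕ) : Type := {c // c ∈ μ.cells} ≃ Fin n

namespace Tableau

variable {μ : YoungDiagram} {n : ℕ}

instance : Finite (Tableau μ n) :=
  inferInstanceAs (Finite ({c // c ∈ μ.cells} ≃ Fin n))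

/-- The index of the row of `T` that contains `i`. -/
def row (T : Tableau μ n) (i : Fin n) : ℕ := (Equiv.symm T i).1.1

/-- The index of the column of `T` that contains `i`. -/
def col (T : Tableau μ n) (i : Fin n) : ℕ := (Equiv.symm T i).1.2

/-- A permutation acts on a tableau by applying it to all the entries. -/
instance : MulAction (Perm (Fin n)) (Tableau μ n) where
  smul σ T := Equiv.trans T σ
  one_smul _ := rfl
  mul_smul _ _ _ := rfl

theorem row_smul (σ : Perm (Fin n)) (T : Tableau μ n) (i : Fin n) :
    (σ • T).row i = T.row (σ⁻¹ i) := rfl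

theorem col_smul (σ : Perm (Fin n)) (T : Tableau μ n) (i : Fin n) :
    (σ • T).col i = T.col (σ⁻¹ i) := rfl

/-- Two tableaux are row equivalent if every entry lies in the same row of both. -/
instance rowSetoid (μ : YoungDiagram) (n : ℕ) : Setoid (Tableau μ n) where
  r T T' := ∀ i, T.row i = T'.row i
  iseqv := ⟨fun _ _ => rfl, fun h i => (h i).symm, fun h h' i => (h i).trans (h' i)⟩

/-- The column stabilizer of `T`: the permutations that preserve each column of `T`. -/
def columnStabilizer (T : Tableau μ n) : Finset (Perm (Fin n)) :=
  Finset.univ.filter fun σ => ∀ i, T.col (σ i) = T.col i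

theorem conj_mem_columnStabilizer (σ τ : Perm (Fin n)) (T : Tableau μ n) :
    σ * τ * σ⁻¹ ∈ (σ • T).columnStabilizer ↔ τ ∈ T.columnStabilizer := by
  rw [columnStabilizer, columnStabilizer, Finset.mem_filter_univ, Finset.mem_filter_univ]
  simp only [col_smul]
  constructor
  · intro h i
    simpa using h (σ i)
  · intro h i
    simpa using h (σ⁻¹ i)

end Tableau

/-- Tabloids of shape `μ`: row equivalence classes of tableaux. -/
def Tabloid (μ : YoungDiagram) (n : ℕ) : Type := Quotient (Tableau.rowSetoid μ n)

namespace Tabloid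

variable {μ : YoungDiagram} {n : ℕ}

/-- The tabloid of a tableau. -/
def mk (T : Tableau μ n) : Tabloid μ n := Quotient.mk _ T

instance : Finite (Tabloid μ n) :=
  inferInstanceAs (Finite (Quotient (Tableau.rowSetoid μ n)))

instance : MulAction (Perm (Fin n)) (Tabloid μ n) where
  smul σ := Quotient.map (fun T => σ • T) fun _ _ h i => h (σ⁻¹ i)
  one_smul t := by
    induction t using Quotient.inductionOn
    rfl
  mul_smul _ _ t := by
    induction t using Quotient.inductionOn
    rfl

theorem smul_mk (σ : Perm (Fin n)) (T : Tableau μ n) : σ • mk T = mk (σ • T) := rfl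

end Tabloid

/-- The permutation module `M^μ` of `Perm (Fin n)` with basis the tabloids of shape `μ`. -/
abbrev tabloidModule (μ : YoungDiagram) (n : ℕ) :
    Representation ℚ (Perm (Fin n)) (MonoidAlgebra ℚ (Tabloid μ n)) :=
  Representation.ofMulAction ℚ (Perm (Fin n)) (Tabloid μ n)

/-- The polytabloid `e_T = ∑_{τ} sign(τ) {τ T}`, over `τ` in the column stabilizer of `T`. -/
def polytabloid {μ : YoungDiagram} {n : ℕ} (T : Tableau μ n) : MonoidAlgebra ℚ (Tabloid μ n) :=
  ∑ τ ∈ T.columnStabilizer,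
    MonoidAlgebra.single (Tabloid.mk (τ • T)) (((Perm.sign τ : ℤˣ) : ℤ) : ℚ)

theorem tabloidModule_polytabloid {μ : YoungDiagram} {n : ℕ} (σ : Perm (Fin n))
    (T : Tableau μ n) : tabloidModule μ n σ (polytabloid T) = polytabloid (σ • T) := by
  unfold polytabloid
  rw [map_sum]
  refine Finset.sum_bij (fun τ _ => σ * τ * σ⁻¹)
    (fun τ h => (Tableau.conj_mem_columnStabilizer σ τ T).2 h)
    (fun _ _ _ _ h => by simpa using h) (fun τ h => ⟨σ⁻¹ * τ * σ, ?_, by group⟩)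
    (fun τ _ => ?_)
  · rw [← Tableau.conj_mem_columnStabilizer σ]
    simpa [mul_assoc] using h
  · rw [Representation.ofMulAction_single, Tabloid.smul_mk]
    have h : Perm.sign (σ * τ * σ⁻¹) = Perm.sign τ := by
      rw [Perm.sign_mul, Perm.sign_mul, Perm.sign_inv, mul_right_comm, Int.units_mul_self, one_mul]
    rw [h, smul_smul, smul_smul, inv_mul_cancel_right]

/-- The Specht module `S^μ`: the subrepresentation of `M^μ` spanned by all polytabloids. -/
def spechtSubrepresentation (μ : YoungDiagram) (n : ℕ) : Subrepresentation (tabloidModule μ n) where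
  toSubmodule := Submodule.span ℚ (Set.range (polytabloid (μ := μ) (n := n)))
  apply_mem_toSubmodule σ v hv := by
    induction hv using Submodule.span_induction with
    | mem x hx =>
      obtain ⟨T, rfl⟩ := hx
      rw [tabloidModule_polytabloid]
      exact Submodule.subset_span ⟨_, rfl⟩
    | zero => simp
    | add x y _ _ hx hy => rw [map_add]; exact add_mem hx hy
    | smul a x _ hx => rw [map_smul]; exact Submodule.smul_mem _ a hx

instance (μ : YoungDiagram) (n : ℕ) :
    Module.Finite ℚ (spechtSubrepresentation μ n).toSubmodule :=
  Module.Finite.span_of_finite ℚ (Set.finite_range _)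

/-- The irreducible representation `V_μ` of the symmetric group on `n` letters corresponding to a
partition `μ` of `n` (given by its Young diagram), realized as a Specht module. -/
def irreducibleRep (μ : YoungDiagram) (n : ℕ) : FDRep ℚ (Perm (Fin n)) :=
  FDRep.of (spechtSubrepresentation μ n).toRepresentation

/-- The Young diagram of the hook partition `(a + 1, 1, …, 1)` with `b` trailing ones. -/
def hookDiagram (a b : ℕ) : YoungDiagram :=
  YoungDiagram.ofRowLens ((a + 1) :: List.replicate b 1) <| by
    refine List.Pairwise.sortedGE (List.pairwise_cons.2 ⟨fun x hx => ?_, ?_⟩)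
    · rw [List.eq_of_mem_replicate hx]
      exact Nat.le_add_left 1 a
    · exact List.pairwise_replicate.2 (Or.inr le_rfl)

/-! ## Graded representations and symmetric sequences -/

/-- The zero representation. -/
def zeroRep (n : ℕ) : FDRep ℚ (Perm (Fin n)) :=
  FDRep.of (Representation.trivial ℚ (Perm (Fin n)) PUnit.{1})

/-- A finite-dimensional graded rational representation of the symmetric group on `n` letters:
one representation in every degree `d : ℕ`, and only finitely many of them are nonzero. -/
structure GradedRep (n : ℕ) where
  component : ℕ → FDRep ℚ (Perm (Fin n))
  finite_support : {d | Nontrivial (component d)}.Finite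

namespace GradedRep

variable {n : ℕ}

theorem not_nontrivial_zeroRep (n : ℕ) : ¬ Nontrivial (zeroRep n) :=
  not_nontrivial_iff_subsingleton.2 (inferInstanceAs (Subsingleton PUnit.{1}))

/-- A representation, regarded as a graded representation concentrated in degree `0`. -/
def ofRep (V : FDRep ℚ (Perm (Fin n))) : GradedRep n where
  component d := if d = 0 then V else zeroRep n
  finite_support := (Set.finite_singleton 0).subset fun d hd => by
    by_contra h
    rw [Set.mem_ofPred_eq, if_neg (by simpa using h)] at hd
    exact not_nontrivial_zeroRep n hd

/-- The degree `m` suspension `s^m V`: `(s^m V)_d = V_{d - m}`, which is zero for `d < m`. -/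
def suspension (m : ℕ) (V : GradedRep n) : GradedRep n where
  component d := if m ≤ d then V.component (d - m) else zeroRep n
  finite_support := (V.finite_support.image (· + m)).subset fun d hd => by
    rw [Set.mem_ofPred_eq] at hd
    split_ifs at hd with h
    · exact ⟨d - m, hd, Nat.sub_add_cancel h⟩
    · exact absurd hd (not_nontrivial_zeroRep n)

/-- The zero graded representation. -/
def zero (n : ℕ) : GradedRep n := ofRep (zeroRep n)

/-- The graded trace `∑_d tr(σ | V_d) q^d`, a polynomial in `q`. -/
def gradedTrace (V : GradedRep n) (σ : Perm (Fin n)) : Polynomial ℚ :=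
  ∑ d ∈ V.finite_support.toFinset, Polynomial.monomial d ((V.component d).character σ)

end GradedRep

/-- A symmetric sequence: a graded representation of the symmetric group on `n` letters for each
`n ≥ 0`. -/
abbrev SymmetricSequence : Type 1 := (n : ℕ) → GradedRep n

/-! ## Cycle index sums

The power series ring `ℚ[q]⟦p₁, p₂, p₃, …⟧`. -/

/-- Formal power series in the variables `p₁, p₂, p₃, …` with coefficients in `ℚ[q]`. -/
abbrev CycleIndexRing : Type := MvPowerSeries ℕ+ (Polynomial ℚ)

namespace CycleIndexRing

/-- The variable `p_i`. -/
def p (i : ℕ+) : CycleIndexRing := MvPowerSeries.X i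

/-- The variable `q`. -/
def q : CycleIndexRing := MvPowerSeries.C Polynomial.X

/-- The formal (coefficientwise) sum of a family of power series in which each monomial occurs
only finitely many times. -/
def formalSum {ι : Type} (f : ι → CycleIndexRing) : CycleIndexRing :=
  fun m => ∑ᶠ i, MvPowerSeries.coeff m (f i)

/-- The series `∑_{i ≥ 1} p_i / i`. -/
def powerSum : CycleIndexRing := formalSum fun i : ℕ+ => ((i : ℚ)⁻¹) • p i

/-- The exponential of a power series (without constant term). -/
def exp (f : CycleIndexRing) : CycleIndexRing := (PowerSeries.exp ℚ).subst f

/-- The cardinality degree of a monomial, where `p_i` has degree `i`. -/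
def cardinalityDegree (m : ℕ+ →₀ ℕ) : ℕ := Finsupp.weight (fun i : ℕ+ => (i : ℕ)) m

/-- The truncation `(f)_{≤ N}`: the terms of `f` of cardinality degree at most `N`. -/
def truncation (N : ℕ) (f : CycleIndexRing) : CycleIndexRing :=
  fun m => if cardinalityDegree m ≤ N then MvPowerSeries.coeff m f else 0

end CycleIndexRing

/-- The number `ℓ_j(σ)` of cycles of length `j` of `σ`, fixed points being cycles of length `1`. -/
def cycleCount {n : ℕ} (j : ℕ) (σ : Perm (Fin n)) : ℕ := σ.partition.parts.count j

/-- The cycle index sum `Z_V = (1 / n!) ∑_σ tr(σ) ∏_j p_j ^ ℓ_j(σ)`. A permutation of `n` letters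
only has cycles of lengths `1, …, n`. -/
def GradedRep.cycleIndexSum {n : ℕ} (V : GradedRep n) : CycleIndexRing :=
  ((n.factorial : ℚ)⁻¹) • ∑ σ : Perm (Fin n),
    MvPowerSeries.C (V.gradedTrace σ) *
      ∏ j ∈ Finset.range n, CycleIndexRing.p j.succPNat ^ cycleCount (j + 1) σ

/-- The cycle index sum `Z_M = ∑_{n ≥ 0} Z_{M(n)}` of a symmetric sequence. -/
def SymmetricSequence.cycleIndexSum (M : SymmetricSequence) : CycleIndexRing :=
  CycleIndexRing.formalSum fun n : ℕ => (M n).cycleIndexSum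

/-! ## The symmetric sequence of hooks -/

/-- The symmetric sequence of hooks: in arity `n ≥ k` it is the `(k - 2)`-fold suspension of the
irreducible representation of the hook partition `(n - k + 1, 1^{k-1})` of `n`, and it is zero in
arities `n < k`. It is used for `k ≥ 2` only. -/
def hookSequence (k : ℕ) : SymmetricSequence := fun n =>
  if k ≤ n then
    (GradedRep.ofRep (irreducibleRep (hookDiagram (n - k) (k - 1)) n)).suspension (k - 2)
  else GradedRep.zero n

end

noncomputable section

open Equiv

/-! ## Alternating functions on tuples -/

namespace TupleFunction

variable {α : Type*} {b : ℕ}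

/-! Alternating functions on `b`-tuples in `Fin n` model the exterior power `Λ^b ℚ^n`, and summing
over the first entry is a Koszul-type differential `∂ : Λ^(b+1) → Λ^b`. The proof identifies the
hook Specht module of shape `(n-b, 1^b)` with the image `B_b` of `∂`: a hook tabloid is the tuple of
entries below its corner (`leg`), the column stabilizer permutes the first column only, and dropping
the corner entry is `∂`, so a polytabloid becomes `∂` of an antisymmetrized basis tuple
(`map_toTupleFunction_spechtSubrepresentation`).

For `n > 0` the complex is exact, since `∂δ + δ∂` is, after normalization, multiplication by `n`
(`boundary_coboundary_succ`). In terms of traces, `tr B_(b+1) = tr Λ^(b+1) - tr B_b`, so `(-1)^b tr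
B_b` is the alternating sum of `tr Λ^j` over `j ≤ b` (`neg_one_pow_mul_boundariesTrace`).

As `Λ^j ℚ^n` is induced from sign tensor trivial on `Σ_j × Σ_(n-j)`, its cycle index is a product of
a sign series and a trivial series (`sum_alternatingTrace_smul`). Counting permutations by cycle
type shows that the trivial series are the homogeneous parts of `exp(∑ p_i/i)`, and that `(-1)^j`
times the sign series are those of `exp(-∑ p_i/i)`. Bounding `j` by `b = k-1` is precisely the
truncation.

Arity `0` is the exception: there `Λ^0` is one-dimensional and the complex is not exact. The product
of exponentials has constant term `1` while the hook sequence vanishes, and the isolated summand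
`(-q)^(k-2)` cancels that term. -/

/-- The action of a permutation on functions of tuples. -/
def permAction (b : ℕ) (σ : Perm α) : ((Fin b → α) → ℚ) →ₗ[ℚ] ((Fin b → α) → ℚ) :=
  LinearMap.funLeft ℚ ℚ fun x i => σ⁻¹ (x i)

/-- The (unnormalized) antisymmetrization of a function of tuples. -/
def alternation (α : Type*) (b : ℕ) : ((Fin b → α) → ℚ) →ₗ[ℚ] ((Fin b → α) → ℚ) :=
  ∑ ρ : Perm (Fin b), ((Perm.sign ρ : ℤ) : ℚ) • LinearMap.funLeft ℚ ℚ fun x i => x (ρ i)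

/-- Summation over the first entry of a tuple. -/
def boundary (α : Type*) [Fintype α] (b : ℕ) :
    ((Fin (b + 1) → α) → ℚ) →ₗ[ℚ] ((Fin b → α) → ℚ) :=
  ∑ y : α, LinearMap.funLeft ℚ ℚ fun x => (Fin.cons y x : Fin (b + 1) → α)

/-- The antisymmetrization of the pullback along the map that forgets the first entry. -/
def coboundary (α : Type*) (b : ℕ) :
    ((Fin b → α) → ℚ) →ₗ[ℚ] ((Fin (b + 1) → α) → ℚ) :=
  alternation α (b + 1) ∘ₗ LinearMap.funLeft ℚ ℚ fun x => (Fin.tail x : Fin b → α)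

/-- A function of tuples is alternating if permuting the entries changes it by the sign. -/
def IsAlternating (φ : (Fin b → α) → ℚ) : Prop :=
  ∀ (τ : Perm (Fin b)) (x : Fin b → α), φ (fun i => x (τ i)) = ((Perm.sign τ : ℤ) : ℚ) * φ x

theorem permAction_apply (σ : Perm α) (φ : (Fin b → α) → ℚ) (x : Fin b → α) :
    permAction b σ φ x = φ fun i => σ⁻¹ (x i) := rfl

theorem alternation_apply (φ : (Fin b → α) → ℚ) (x : Fin b → α) :
    alternation α b φ x =
      ∑ ρ : Perm (Fin b), ((Perm.sign ρ : ℤ) : ℚ) * φ fun i => x (ρ i) := by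
  simp [alternation, LinearMap.sum_apply, Finset.sum_apply, LinearMap.funLeft_apply]

theorem sign_mul_self (τ : Perm (Fin b)) :
    ((Perm.sign τ : ℤ) : ℚ) * ((Perm.sign τ : ℤ) : ℚ) = 1 := by
  rw [← Int.cast_mul, ← Units.val_mul, Int.units_mul_self]; simp

theorem isAlternating_alternation (φ : (Fin b → α) → ℚ) : IsAlternating (alternation α b φ) := by
  intro τ x
  rw [alternation_apply, alternation_apply, Finset.mul_sum]
  refine Fintype.sum_equiv (Equiv.mulLeft τ) _ _ fun ρ => ?_
  rw [Equiv.coe_mulLeft, Perm.sign_mul, Units.val_mul, Int.cast_mul, ← mul_assoc, ← mul_assoc,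
    sign_mul_self, one_mul]
  rfl

theorem IsAlternating.alternation_eq {φ : (Fin b → α) → ℚ} (h : IsAlternating φ) :
    alternation α b φ = (b.factorial : ℚ) • φ := by
  ext x
  rw [alternation_apply, Finset.sum_congr rfl fun ρ _ => by
    rw [h ρ x, ← mul_assoc, sign_mul_self, one_mul]]
  simp [Fintype.card_perm]

theorem alternation_permAction (σ : Perm α) (φ : (Fin b → α) → ℚ) :
    alternation α b (permAction b σ φ) = permAction b σ (alternation α b φ) := by
  ext x
  simp only [alternation_apply, permAction_apply]

/-- Split the permutations of `Fin (b + 1)` by the image `p` of `0`. On each coset the alternation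
of `φ` absorbs the remaining sign, so all `b!` terms agree; the coset of `0` has sign `+1` and the
others `-1`. -/
theorem IsAlternating.coboundary_apply {φ : (Fin b → α) → ℚ} (h : IsAlternating φ)
    (x : Fin (b + 1) → α) :
    coboundary α b φ x = (b.factorial : ℚ) *
      (φ (Fin.tail x) - ∑ p : Fin b, φ fun i => x (swap 0 p.succ i.succ)) := by
  rw [coboundary, LinearMap.comp_apply, alternation_apply,
    ← Equiv.sum_comp Perm.decomposeFin.symm, Fintype.sum_prod_type]
  have key : ∀ (p : Fin (b + 1)) (e : Perm (Fin b)),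
      ((Perm.sign (Perm.decomposeFin.symm (p, e)) : ℤ) : ℚ) *
        (LinearMap.funLeft ℚ ℚ (fun x => (Fin.tail x : Fin b → α)) φ) (fun i =>
          x (Perm.decomposeFin.symm (p, e) i)) =
      (if p = 0 then 1 else -1) * φ fun i => x (swap 0 p i.succ) := by
    intro p e
    have h1 : (LinearMap.funLeft ℚ ℚ (fun x => (Fin.tail x : Fin b → α)) φ) (fun i =>
          x (Perm.decomposeFin.symm (p, e) i)) =
          ((Perm.sign e : ℤ) : ℚ) * φ fun i => x (swap 0 p i.succ) := by
      rw [← h e, LinearMap.funLeft_apply]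
      congr 1
      ext i
      simp [Fin.tail]
    rw [h1, Perm.decomposeFin.symm_sign, Units.val_mul, Int.cast_mul, mul_assoc,
      ← mul_assoc ((Perm.sign e : ℤ) : ℚ), sign_mul_self, one_mul]
    split_ifs <;> simp
  simp only [key, Finset.sum_const, Finset.card_univ, Fintype.card_perm, Fintype.card_fin,
    nsmul_eq_mul, ← Finset.mul_sum]
  rw [Fin.sum_univ_succ]
  simp [Fin.tail_def, Fin.succ_ne_zero, sub_eq_add_neg]

variable [Fintype α]

theorem boundary_apply (φ : (Fin (b + 1) → α) → ℚ) (x : Fin b → α) :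
    boundary α b φ x = ∑ y : α, φ (Fin.cons y x) := by
  simp [boundary, LinearMap.sum_apply, Finset.sum_apply, LinearMap.funLeft_apply]

theorem boundary_permAction (σ : Perm α) (φ : (Fin (b + 1) → α) → ℚ) :
    boundary α b (permAction (b + 1) σ φ) = permAction b σ (boundary α b φ) := by
  ext x
  simp only [boundary_apply, permAction_apply]
  refine Fintype.sum_equiv σ⁻¹ _ _ fun y => congrArg φ ?_
  ext i
  refine Fin.cases ?_ (fun i => ?_) i <;> simp

/-- A permutation of the tuple extends, with the same sign, to one fixing the added first entry. -/
theorem IsAlternating.boundary {φ : (Fin (b + 1) → α) → ℚ} (h : IsAlternating φ) :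
    IsAlternating (boundary α b φ) := by
  intro τ x
  rw [boundary_apply, boundary_apply, Finset.mul_sum]
  refine Finset.sum_congr rfl fun y _ => ?_
  have := h (Perm.decomposeFin.symm (0, τ)) (Fin.cons y x)
  rw [Perm.decomposeFin.symm_sign, if_pos rfl, one_mul] at this
  rw [← this]
  congr 1
  ext i
  refine Fin.cases ?_ (fun i => ?_) i <;> simp

/-- The double sum over the two leading entries is antisymmetric under exchanging them, hence equals
its own negative. -/
theorem IsAlternating.boundary_boundary {φ : (Fin (b + 2) → α) → ℚ} (h : IsAlternating φ) :
    TupleFunction.boundary α b (TupleFunction.boundary α (b + 1) φ) = 0 := by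
  ext x
  have key : ∀ y z : α, φ (Fin.cons y (Fin.cons z x)) = -φ (Fin.cons z (Fin.cons y x)) := by
    intro y z
    have := h (swap 0 1) (Fin.cons z (Fin.cons y x))
    rw [Perm.sign_swap (by simp)] at this
    rw [Units.val_neg, Units.val_one, Int.cast_neg, Int.cast_one, neg_one_mul] at this
    rw [← this]
    congr 1
    ext i
    refine Fin.cases ?_ (fun i => Fin.cases ?_ (fun i => ?_) i) i
    · simp
    · simp
    · rw [swap_apply_of_ne_of_ne (Fin.succ_ne_zero _) (by simp [Fin.ext_iff])]
      simp
  simp only [boundary_apply, Pi.zero_apply]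
  have h2 : ∑ z : α, ∑ y : α, φ (Fin.cons y (Fin.cons z x)) =
      -∑ z : α, ∑ y : α, φ (Fin.cons y (Fin.cons z x)) := by
    conv_lhs => rw [Finset.sum_comm]
    simp only [← Finset.sum_neg_distrib]
    exact Finset.sum_congr rfl fun y _ => Finset.sum_congr rfl fun z _ => key y z
  linarith

theorem IsAlternating.boundary_coboundary {φ : (Fin b → α) → ℚ} (h : IsAlternating φ)
    (x : Fin b → α) :
    TupleFunction.boundary α b (coboundary α b φ) x = (b.factorial : ℚ) *
      (Fintype.card α * φ x - ∑ p : Fin b, ∑ y : α, φ (Function.update x p y)) := by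
  rw [boundary_apply, Finset.sum_comm, Finset.sum_congr rfl fun y _ => h.coboundary_apply _,
    ← Finset.mul_sum, Finset.sum_sub_distrib]
  simp only [Fin.tail_cons, Finset.sum_const, Finset.card_univ, nsmul_eq_mul]
  congr 3
  ext y
  -- Swapping the new entry `y` with position `p` and dropping the front leaves `x` with its `p`-th
  -- entry replaced by `y`.
  refine Finset.sum_congr rfl fun p _ => congrArg φ ?_
  ext i
  rcases eq_or_ne i p with rfl | hi
  · simp
  · rw [swap_apply_of_ne_of_ne (Fin.succ_ne_zero _) (by simpa using hi),
      Function.update_of_ne hi, Fin.cons_succ]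

theorem IsAlternating.boundary_coboundary_zero {φ : (Fin 0 → α) → ℚ} (h : IsAlternating φ) :
    TupleFunction.boundary α 0 (coboundary α 0 φ) = (Fintype.card α : ℚ) • φ := by
  ext x
  simp [h.boundary_coboundary]

/-- This is the homotopy formula. The sums over replaced entries in `∂δφ` are, up to a transposition
sign, the terms of `δ∂φ`: replacing entry `0` gives the leading term, and replacing a later entry
gives a swapped one. -/
theorem IsAlternating.boundary_coboundary_succ {φ : (Fin (b + 1) → α) → ℚ}
    (h : IsAlternating φ) :
    TupleFunction.boundary α (b + 1) (coboundary α (b + 1) φ) =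
      (((b + 1).factorial : ℚ) * Fintype.card α) • φ -
        ((b : ℚ) + 1) • coboundary α b (TupleFunction.boundary α b φ) := by
  ext x
  rw [h.boundary_coboundary, Pi.sub_apply, Pi.smul_apply, Pi.smul_apply, smul_eq_mul,
    smul_eq_mul, h.boundary.coboundary_apply, Fin.sum_univ_succ]
  simp only [boundary_apply]
  have h0 : ∀ y, Function.update x 0 y = Fin.cons y (Fin.tail x) := fun y => by
    ext i
    refine Fin.cases ?_ (fun i => ?_) i <;> simp [Fin.tail]
  have h1 : ∀ (p : Fin b) (y : α), φ (Function.update x p.succ y) =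
      -φ (Fin.cons y fun i => x (swap 0 p.succ i.succ)) := by
    intro p y
    have := h (swap 0 p.succ) (Fin.cons y fun i => x (swap 0 p.succ i.succ))
    rw [Perm.sign_swap (Fin.succ_ne_zero p).symm, Units.val_neg, Units.val_one, Int.cast_neg,
      Int.cast_one, neg_one_mul] at this
    rw [← this]
    congr 1
    ext i
    rcases eq_or_ne i p.succ with rfl | hi
    · simp
    · rw [Function.update_of_ne hi]
      refine Fin.cases (fun _ => by simp) (fun i hi => ?_) i hi
      rw [swap_apply_of_ne_of_ne (Fin.succ_ne_zero _) hi, Fin.cons_succ,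
        swap_apply_of_ne_of_ne (Fin.succ_ne_zero _) hi]
  simp only [h0, h1, Finset.sum_neg_distrib, Nat.factorial_succ]
  push_cast
  ring

end TupleFunction

/-! ### Traces on exterior powers and on boundaries -/

namespace TupleFunction

variable {α : Type*} {b : ℕ}

variable [Fintype α]

/-- The trace of a permutation on the space of alternating functions of tuples. -/
def alternatingTrace (b : ℕ) (σ : Perm α) : ℚ :=
  (b.factorial : ℚ)⁻¹ * LinearMap.trace ℚ _ (permAction b σ ∘ₗ alternation α b)

/-- The image of the alternating functions under summation over the first entry. -/
def boundaries (α : Type*) [Fintype α] (b : ℕ) : Submodule ℚ ((Fin b → α) → ℚ) :=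
  LinearMap.range (boundary α b ∘ₗ alternation α (b + 1))

theorem permAction_mem_boundaries (σ : Perm α) :
    ∀ φ ∈ boundaries α b, permAction b σ φ ∈ boundaries α b := by
  rintro _ ⟨φ, rfl⟩
  refine ⟨permAction (b + 1) σ φ, ?_⟩
  rw [LinearMap.comp_apply, LinearMap.comp_apply, alternation_permAction, boundary_permAction]

/-- The trace of a permutation on the space of boundaries. -/
def boundariesTrace (b : ℕ) (σ : Perm α) : ℚ :=
  LinearMap.trace ℚ _ ((permAction b σ).restrict (permAction_mem_boundaries (b := b) σ))

theorem isAlternating_of_mem_boundaries {φ : (Fin b → α) → ℚ} (h : φ ∈ boundaries α b) :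
    IsAlternating φ := by
  obtain ⟨ψ, rfl⟩ := h
  exact (isAlternating_alternation ψ).boundary

theorem boundary_coboundary_of_mem_boundaries {φ : (Fin b → α) → ℚ} (h : φ ∈ boundaries α b) :
    boundary α b (coboundary α b φ) = ((b.factorial : ℚ) * Fintype.card α) • φ := by
  have hφ := isAlternating_of_mem_boundaries h
  cases b with
  | zero => rw [hφ.boundary_coboundary_zero]; simp
  | succ b =>
    obtain ⟨ψ, rfl⟩ := h
    rw [hφ.boundary_coboundary_succ, LinearMap.comp_apply,
      (isAlternating_alternation ψ).boundary_boundary, map_zero, smul_zero, sub_zero]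

theorem boundary_coboundary_mem (φ : (Fin b → α) → ℚ) :
    boundary α b (coboundary α b φ) ∈ boundaries α b := ⟨_, rfl⟩

/-- On boundaries `alternation` is multiplication by `b!` and `∂δ` by `b! * n`, while the composite
maps everything into the boundaries. A scalar multiple of it is thus a projection, and the trace can
be taken on the whole function space. -/
theorem boundariesTrace_eq [Nonempty α] (b : ℕ) (σ : Perm α) :
    boundariesTrace b σ = (Fintype.card α : ℚ)⁻¹ * ((b.factorial : ℚ)⁻¹ * ((b.factorial : ℚ)⁻¹ *
      LinearMap.trace ℚ _
        (permAction b σ ∘ₗ boundary α b ∘ₗ coboundary α b ∘ₗ alternation α b))) := by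
  have hmem : ∀ φ, (permAction b σ ∘ₗ boundary α b ∘ₗ coboundary α b ∘ₗ alternation α b) φ ∈
      boundaries α b := fun φ => permAction_mem_boundaries σ _ (boundary_coboundary_mem _)
  rw [← LinearMap.trace_restrict_eq_of_forall_mem (boundaries α b) _ hmem, ← smul_eq_mul,
    ← smul_eq_mul, ← smul_eq_mul, ← map_smul, ← map_smul, ← map_smul, boundariesTrace]
  congr 1
  ext ⟨φ, hφ⟩ : 2
  simp only [LinearMap.restrict_apply, LinearMap.smul_apply, SetLike.mk_smul_mk,
    LinearMap.comp_apply]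
  rw [(isAlternating_of_mem_boundaries hφ).alternation_eq, map_smul, map_smul,
    boundary_coboundary_of_mem_boundaries hφ, map_smul, map_smul, smul_smul, smul_smul, smul_smul,
    smul_smul]
  have h1 : (b.factorial : ℚ) ≠ 0 := by positivity
  have h2 : (Fintype.card α : ℚ) ≠ 0 := by simp
  rw [eq_comm]
  convert one_smul ℚ _
  field_simp

theorem boundariesTrace_zero [Nonempty α] (σ : Perm α) :
    boundariesTrace 0 σ = alternatingTrace 0 σ := by
  have h : boundary α 0 ∘ₗ coboundary α 0 ∘ₗ alternation α 0 =
      (Fintype.card α : ℚ) • alternation α 0 :=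
    LinearMap.ext fun φ => (isAlternating_alternation φ).boundary_coboundary_zero
  rw [boundariesTrace_eq, h, LinearMap.comp_smul, map_smul, alternatingTrace]
  simp

/-- Exactness expressed through traces: insert the homotopy formula into `boundariesTrace_eq` and
use cyclicity to turn the `δ∂` term into a trace one degree lower. -/
theorem boundariesTrace_succ [Nonempty α] (b : ℕ) (σ : Perm α) :
    boundariesTrace (b + 1) σ = alternatingTrace (b + 1) σ - boundariesTrace b σ := by
  -- The additional `alternation α b`, compensated by `(b!)⁻¹`, makes the last factor the map whose
  -- range is `boundaries α b`, ready for cyclic rotation.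
  have h : boundary α (b + 1) ∘ₗ coboundary α (b + 1) ∘ₗ alternation α (b + 1) =
      (((b + 1).factorial : ℚ) * Fintype.card α) • alternation α (b + 1) -
        (((b : ℚ) + 1) * (b.factorial : ℚ)⁻¹) •
          (coboundary α b ∘ₗ alternation α b) ∘ₗ (boundary α b ∘ₗ alternation α (b + 1)) :=
    LinearMap.ext fun φ => by
      have hφ := isAlternating_alternation φ
      simp only [LinearMap.comp_apply, LinearMap.sub_apply, LinearMap.smul_apply]
      rw [hφ.boundary_coboundary_succ, hφ.boundary.alternation_eq, map_smul, smul_smul,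
        inv_mul_cancel_right₀ (by positivity)]
  have h' : (boundary α b ∘ₗ alternation α (b + 1)) ∘ₗ (permAction (b + 1) σ ∘ₗ
      (coboundary α b ∘ₗ alternation α b)) = ((b + 1).factorial : ℚ) • (permAction b σ ∘ₗ
        boundary α b ∘ₗ coboundary α b ∘ₗ alternation α b) :=
    LinearMap.ext fun φ => by
      simp only [LinearMap.comp_apply, LinearMap.smul_apply]
      rw [alternation_permAction, coboundary, LinearMap.comp_apply,
        (isAlternating_alternation _).alternation_eq, map_smul, map_smul, boundary_permAction]
  rw [boundariesTrace_eq, boundariesTrace_eq, h, LinearMap.comp_sub, map_sub, LinearMap.comp_smul,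
    LinearMap.comp_smul, map_smul, map_smul, ← LinearMap.comp_assoc,
    LinearMap.trace_comp_comm' (boundary α b ∘ₗ alternation α (b + 1)), h',
    map_smul, alternatingTrace]
  have h1 : (b.factorial : ℚ) ≠ 0 := by positivity
  have h2 : (Fintype.card α : ℚ) ≠ 0 := by simp
  simp only [smul_eq_mul, Nat.factorial_succ]
  push_cast
  field_simp

theorem neg_one_pow_mul_boundariesTrace [Nonempty α] (b : ℕ) (σ : Perm α) :
    (-1) ^ b * boundariesTrace b σ =
      ∑ j ∈ Finset.range (b + 1), (-1) ^ j * alternatingTrace j σ := by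
  induction b with
  | zero => simp [boundariesTrace_zero]
  | succ b ih =>
    rw [Finset.sum_range_succ, ← ih, boundariesTrace_succ]
    ring

/-- The trace is read off in the basis of indicator functions: a tuple contributes for each `ρ` that
describes how `σ` permutes its entries. -/
theorem alternatingTrace_eq [DecidableEq α] (b : ℕ) (σ : Perm α) :
    alternatingTrace b σ = (b.factorial : ℚ)⁻¹ * ∑ ρ : Perm (Fin b), ∑ x : Fin b → α,
      if ∀ i, σ (x i) = x (ρ i) then ((Perm.sign ρ : ℤ) : ℚ) else 0 := by
  rw [alternatingTrace, LinearMap.trace_eq_matrix_trace ℚ (Pi.basisFun ℚ (Fin b → α)),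
    Matrix.trace, Finset.sum_comm]
  congr 1
  refine Finset.sum_congr rfl fun x _ => ?_
  rw [Matrix.diag_apply, LinearMap.toMatrix_apply]
  simp only [Pi.basisFun_repr, LinearMap.comp_apply, Pi.basisFun_apply, permAction_apply,
    alternation_apply]
  refine Finset.sum_congr rfl fun ρ _ => ?_
  have : ((fun i => σ⁻¹ (x (ρ i))) = x) ↔ ∀ i, σ (x i) = x (ρ i) := by
    rw [funext_iff]
    refine forall_congr' fun i => ?_
    rw [Perm.inv_eq_iff_eq, eq_comm]
  rw [Pi.single_apply]
  simp only [this, mul_ite, mul_one, mul_zero]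

end TupleFunction

/-! ### Action of the operators on indicator functions -/

namespace TupleFunction

variable {α : Type*} [DecidableEq α] {b : ℕ}

theorem permAction_single (σ : Perm α) (x : Fin b → α) :
    permAction b σ (Pi.single x 1) = Pi.single (fun i => σ (x i)) 1 := by
  ext y
  rw [permAction_apply, Pi.single_apply, Pi.single_apply]
  congr 1
  rw [funext_iff, funext_iff]
  exact propext (forall_congr' fun i => Perm.inv_eq_iff_eq)

theorem alternation_single (x : Fin b → α) :
    alternation α b (Pi.single x 1) =
      ∑ ρ : Perm (Fin b), ((Perm.sign ρ : ℤ) : ℚ) • Pi.single (fun i => x (ρ i)) 1 := by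
  ext y
  rw [alternation_apply, Finset.sum_apply]
  refine Fintype.sum_equiv (Equiv.inv _) _ _ fun ρ => ?_
  rw [Equiv.inv_apply, Perm.sign_inv, Pi.smul_apply, smul_eq_mul, Pi.single_apply, Pi.single_apply]
  congr 2
  rw [funext_iff, funext_iff]
  refine propext ⟨fun h i => ?_, fun h i => ?_⟩
  · rw [← h]; simp
  · rw [h]; simp

theorem alternation_single_of_not_injective {x : Fin b → α} (hx : ¬ Function.Injective x) :
    alternation α b (Pi.single x 1) = 0 := by
  rw [Function.not_injective_iff] at hx
  obtain ⟨i, j, hij, hne⟩ := hx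
  have hswap : ∀ k, x (swap i j k) = x k := by
    intro k
    rw [swap_apply_def]
    split_ifs with h1 h2
    · rw [h1, hij]
    · rw [h2, hij]
    · rfl
  -- Composing with the transposition of two equal entries fixes the tuple but flips every sign.
  have h : alternation α b (Pi.single x 1) = -alternation α b (Pi.single x 1) := by
    conv_lhs => rw [alternation_single, ← Equiv.sum_comp (Equiv.mulLeft (swap i j))]
    rw [alternation_single, ← Finset.sum_neg_distrib]
    refine Finset.sum_congr rfl fun ρ _ => ?_
    simp [Perm.sign_mul, Perm.sign_swap hne, hswap]
  exact self_eq_neg.1 h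

theorem boundary_single [Fintype α] (x : Fin (b + 1) → α) :
    boundary α b (Pi.single x 1) = Pi.single (Fin.tail x) 1 := by
  ext y
  rw [boundary_apply, Pi.single_apply]
  have h : ∀ z, (Fin.cons z y : Fin (b + 1) → α) = x ↔ z = x 0 ∧ y = Fin.tail x := fun z => by
    rw [← Fin.cons_inj (α := fun _ => α), Fin.cons_self_tail]
  simp only [Pi.single_apply, h, ite_and]
  simp

/-- A `(b + 1)`-tuple cannot be injective here, so there are no nonzero alternating functions to
take boundaries of. -/
theorem boundariesTrace_eq_zero [Fintype α] (h : Fintype.card α ≤ b) (σ : Perm α) :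
    boundariesTrace b σ = 0 := by
  have h0 : alternation α (b + 1) = 0 := (Pi.basisFun ℚ (Fin (b + 1) → α)).ext fun x => by
    rw [Pi.basisFun_apply, alternation_single_of_not_injective, LinearMap.zero_apply]
    intro hx
    have := Fintype.card_le_of_injective x hx
    rw [Fintype.card_fin] at this
    omega
  have : Subsingleton (boundaries α b) := by
    rw [boundaries, h0, LinearMap.comp_zero, LinearMap.range_zero]
    infer_instance
  rw [boundariesTrace, Subsingleton.elim ((permAction b σ).restrict _) 0, map_zero]

end TupleFunction

/-! ### Tableaux and tabloids of hook shape -/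

theorem mem_hookDiagram {a b : ℕ} {c : ℕ × ℕ} :
    c ∈ hookDiagram a b ↔ c.1 = 0 ∧ c.2 ≤ a ∨ c.2 = 0 ∧ c.1 ≤ b := by
  obtain ⟨i, j⟩ := c
  rw [hookDiagram, YoungDiagram.mem_ofRowLens]
  cases i with
  | zero => simp; omega
  | succ i => simp; omega

theorem card_cells_hookDiagram (a b : ℕ) : (hookDiagram a b).cells.card = a + b + 1 := by
  have : (hookDiagram a b).cells = (Finset.range (a + 1)).image (fun j => (0, j)) ∪
      (Finset.range b).image fun i => (i + 1, 0) := by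
    ext ⟨i, j⟩
    rw [YoungDiagram.mem_cells, mem_hookDiagram]
    simp only [Finset.mem_union, Finset.mem_image, Finset.mem_range, Prod.mk.injEq]
    constructor
    · rintro (⟨h, h'⟩ | ⟨h, h'⟩)
      · exact Or.inl ⟨j, by omega, h.symm, rfl⟩
      · rcases Nat.eq_zero_or_pos i with hi | hi
        · exact Or.inl ⟨0, by omega, hi.symm, h.symm⟩
        · exact Or.inr ⟨i - 1, by omega, by omega, h.symm⟩
    · rintro (⟨x, h, h', rfl⟩ | ⟨x, h, h', h''⟩)
      · exact Or.inl ⟨h'.symm, by omega⟩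
      · exact Or.inr ⟨h''.symm, by omega⟩
  rw [this, Finset.card_union_of_disjoint, Finset.card_image_of_injective,
    Finset.card_image_of_injective, Finset.card_range, Finset.card_range]
  · omega
  · intro x y h; simpa using h
  · intro x y h; simpa using h
  · rw [Finset.disjoint_left]
    simp

namespace Tableau

variable {a b n : ℕ}

theorem mem_cells_firstColumn (a : ℕ) (i : Fin (b + 1)) :
    ((i : ℕ), 0) ∈ (hookDiagram a b).cells :=
  (YoungDiagram.mem_cells _).2 (mem_hookDiagram.2 (Or.inr ⟨rfl, Nat.lt_succ_iff.1 i.2⟩))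

/-- The underlying bijection of a tableau. -/
def toEquiv {μ : YoungDiagram} (T : Tableau μ n) : {c // c ∈ μ.cells} ≃ Fin n := T

/-- The entries in the first column of a tableau of hook shape. -/
def firstColumn (T : Tableau (hookDiagram a b) n) (i : Fin (b + 1)) : Fin n :=
  T.toEquiv ⟨(i, 0), mem_cells_firstColumn a i⟩

theorem firstColumn_injective (T : Tableau (hookDiagram a b) n) :
    Function.Injective T.firstColumn := fun i j h => by
  simpa [Fin.ext_iff] using T.toEquiv.injective h

theorem firstColumn_smul (σ : Perm (Fin n)) (T : Tableau (hookDiagram a b) n) (i : Fin (b + 1)) :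
    (σ • T).firstColumn i = σ (T.firstColumn i) := rfl

theorem row_firstColumn (T : Tableau (hookDiagram a b) n) (i : Fin (b + 1)) :
    T.row (T.firstColumn i) = i := by
  change (T.toEquiv.symm (T.toEquiv _)).1.1 = _
  rw [Equiv.symm_apply_apply]

theorem col_firstColumn (T : Tableau (hookDiagram a b) n) (i : Fin (b + 1)) :
    T.col (T.firstColumn i) = 0 := by
  change (T.toEquiv.symm (T.toEquiv _)).1.2 = _
  rw [Equiv.symm_apply_apply]

theorem row_col_mem (T : Tableau (hookDiagram a b) n) (y : Fin n) :
    T.row y = 0 ∧ T.col y ≤ a ∨ T.col y = 0 ∧ T.row y ≤ b :=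
  mem_hookDiagram.1 ((YoungDiagram.mem_cells _).1 (T.toEquiv.symm y).2)

theorem ext_row_col (T : Tableau (hookDiagram a b) n) {y z : Fin n} (h : T.row y = T.row z)
    (h' : T.col y = T.col z) : y = z :=
  T.toEquiv.symm.injective (Subtype.ext (Prod.ext h h'))

theorem eq_firstColumn_of_row (T : Tableau (hookDiagram a b) n) {y : Fin n} {i : Fin b}
    (h : T.row y = i + 1) : y = T.firstColumn i.succ := by
  refine T.ext_row_col (by rw [row_firstColumn, h, Fin.val_succ]) ?_
  rw [col_firstColumn]
  have := T.row_col_mem y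
  omega

theorem eq_firstColumn_of_col (T : Tableau (hookDiagram a b) n) {y : Fin n}
    (h : T.col y = 0) : ∃ i, y = T.firstColumn i := by
  have := T.row_col_mem y
  refine ⟨⟨T.row y, by omega⟩, T.ext_row_col ?_ ?_⟩
  · rw [row_firstColumn]
  · rw [col_firstColumn, h]

theorem exists_firstColumn_eq (hn : a + b + 1 = n) {c : Fin (b + 1) → Fin n}
    (hc : Function.Injective c) : ∃ T : Tableau (hookDiagram a b) n, T.firstColumn = c := by
  have hcard : Fintype.card {c // c ∈ (hookDiagram a b).cells} = Fintype.card (Fin n) := by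
    rw [Fintype.card_coe, card_cells_hookDiagram, hn, Fintype.card_fin]
  let T : Tableau (hookDiagram a b) n := Fintype.equivOfCardEq hcard
  -- Start from any tableau and move its first column onto `c`; a bijection between subsets of a
  -- finite set extends to a permutation.
  let e : {y // y ∈ Set.range T.firstColumn} ≃ {y // y ∈ Set.range c} :=
    (Equiv.ofInjective _ T.firstColumn_injective).symm.trans (Equiv.ofInjective c hc)
  classical
  refine ⟨e.extendSubtype • T, funext fun i => ?_⟩
  rw [firstColumn_smul, e.extendSubtype_apply_of_mem _ ⟨i, rfl⟩]
  have : (⟨T.firstColumn i, ⟨i, rfl⟩⟩ : {y // y ∈ Set.range T.firstColumn}) =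
    Equiv.ofInjective _ T.firstColumn_injective i := rfl
  rw [this, Equiv.trans_apply, Equiv.symm_apply_apply]
  rfl

end Tableau

namespace Tabloid

variable {a b n : ℕ}

/-- The entries in the rows of length one of a tabloid of hook shape. -/
def leg (t : Tabloid (hookDiagram a b) n) : Fin b → Fin n :=
  Quotient.lift (fun T : Tableau (hookDiagram a b) n => Fin.tail T.firstColumn)
    (fun T T' h => funext fun i => T'.eq_firstColumn_of_row <| by
      rw [← h, Fin.tail, Tableau.row_firstColumn, Fin.val_succ]) t

theorem leg_mk (T : Tableau (hookDiagram a b) n) : (mk T).leg = Fin.tail T.firstColumn := rfl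

theorem leg_smul (σ : Perm (Fin n)) (t : Tabloid (hookDiagram a b) n) :
    (σ • t).leg = fun i => σ (t.leg i) := by
  induction t using Quotient.inductionOn
  rfl

/-- Every entry outside the leg lies in row `0`, so the leg fixes the row of each entry. -/
theorem leg_injective : Function.Injective (leg (a := a) (b := b) (n := n)) := by
  intro t t'
  induction t, t' using Quotient.inductionOn₂ with | _ T T' => ?_
  intro h
  replace h : ∀ i : Fin b, T.firstColumn i.succ = T'.firstColumn i.succ := congrFun h
  refine Quotient.sound fun y => ?_
  have key : ∀ S S' : Tableau (hookDiagram a b) n,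
      (∀ i : Fin b, S.firstColumn i.succ = S'.firstColumn i.succ) → S.row y ≠ 0 →
      S.row y = S'.row y := by
    intro S S' h h0
    have h1 := S.row_col_mem y
    obtain ⟨i, hi⟩ : ∃ i : Fin b, S.row y = i + 1 :=
      ⟨⟨S.row y - 1, by omega⟩, by simp only; omega⟩
    rw [hi, S.eq_firstColumn_of_row hi, h, Tableau.row_firstColumn, Fin.val_succ]
  by_cases h0 : T.row y = 0
  · by_cases h1 : T'.row y = 0
    · rw [h0, h1]
    · exact (key T' T (fun i => (h i).symm) h1).symm
  · exact key T T' h h0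

/-- A tabloid of hook shape, regarded as the tuple of the entries in the rows of length one. -/
def toTupleFunction (a b n : ℕ) :
    MonoidAlgebra ℚ (Tabloid (hookDiagram a b) n) →ₗ[ℚ] ((Fin b → Fin n) → ℚ) :=
  Finsupp.linearCombination ℚ (fun t : Tabloid (hookDiagram a b) n => Pi.single t.leg 1) ∘ₗ
    (MonoidAlgebra.coeffLinearEquiv ℚ).toLinearMap

theorem toTupleFunction_single (t : Tabloid (hookDiagram a b) n) (r : ℚ) :
    toTupleFunction a b n (MonoidAlgebra.single t r) = r • Pi.single t.leg 1 := by
  simp [toTupleFunction]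

theorem toTupleFunction_injective : Function.Injective (toTupleFunction a b n) := by
  have h : LinearIndependent ℚ
      (fun t : Tabloid (hookDiagram a b) n => (Pi.single t.leg 1 : (Fin b → Fin n) → ℚ)) := by
    convert (Pi.basisFun ℚ (Fin b → Fin n)).linearIndependent.comp _ (leg_injective (a := a))
    simp
  exact Function.Injective.comp (g := Finsupp.linearCombination ℚ _) h
    (MonoidAlgebra.coeffLinearEquiv ℚ).injective

theorem toTupleFunction_tabloidModule (σ : Perm (Fin n))
    (v : MonoidAlgebra ℚ (Tabloid (hookDiagram a b) n)) :
    toTupleFunction a b n (tabloidModule (hookDiagram a b) n σ v) =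
      TupleFunction.permAction b σ (toTupleFunction a b n v) := by
  rw [← LinearMap.comp_apply, ← LinearMap.comp_apply]
  congr 1
  ext t : 2
  simp only [LinearMap.comp_apply, MonoidAlgebra.lsingle_apply]
  rw [Representation.ofMulAction_single, toTupleFunction_single, toTupleFunction_single, leg_smul,
    one_smul, one_smul, TupleFunction.permAction_single]

/-- All columns but the first have a single cell, so the column stabilizer is the symmetric group of
the first column, and passing to the tabloid forgets its corner entry. -/
theorem toTupleFunction_polytabloid (T : Tableau (hookDiagram a b) n) :
    toTupleFunction a b n (polytabloid T) = TupleFunction.boundary (Fin n) b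
      (TupleFunction.alternation (Fin n) (b + 1) (Pi.single T.firstColumn 1)) := by
  rw [TupleFunction.alternation_single, polytabloid, map_sum, map_sum]
  symm
  let c : Fin (b + 1) ↪ Fin n := ⟨T.firstColumn, T.firstColumn_injective⟩
  refine Finset.sum_bij (fun ρ _ => ρ.viaFintypeEmbedding c) (fun ρ _ => ?_) (fun ρ _ ρ' _ h => ?_)
    (fun τ hτ => ?_) (fun ρ _ => ?_)
  · rw [Tableau.columnStabilizer, Finset.mem_filter_univ]
    intro y
    by_cases hy : y ∈ Set.range c
    · obtain ⟨i, rfl⟩ := hy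
      rw [Perm.viaFintypeEmbedding_apply_image]
      exact (T.col_firstColumn _).trans (T.col_firstColumn _).symm
    · rw [Perm.viaFintypeEmbedding_apply_notMem_range _ _ hy]
  · ext i
    have := congrArg (fun σ => σ (c i)) h
    simp only [Perm.viaFintypeEmbedding_apply_image] at this
    exact congrArg _ (c.injective this)
  · rw [Tableau.columnStabilizer, Finset.mem_filter_univ] at hτ
    choose ρ hρ using fun i => T.eq_firstColumn_of_col ((hτ _).trans (T.col_firstColumn i))
    have hinj : Function.Injective ρ := fun i j h =>
      T.firstColumn_injective (τ.injective (by rw [hρ, hρ, h]))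
    refine ⟨Equiv.ofBijective ρ (Finite.injective_iff_bijective.1 hinj), Finset.mem_univ _, ?_⟩
    ext1 y
    by_cases hy : y ∈ Set.range c
    · obtain ⟨i, rfl⟩ := hy
      rw [Perm.viaFintypeEmbedding_apply_image]
      exact (hρ i).symm
    · rw [Perm.viaFintypeEmbedding_apply_notMem_range _ _ hy]
      -- Outside the first column both `y` and `τ y` lie in row `0`; as they share a column, they
      -- coincide.
      have h0 : T.col y ≠ 0 := fun h => by
        obtain ⟨i, rfl⟩ := T.eq_firstColumn_of_col h
        exact hy ⟨i, rfl⟩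
      have h1 := T.row_col_mem y
      have h2 := T.row_col_mem (τ y)
      have h3 := hτ y
      exact T.ext_row_col (by omega) h3.symm
  · rw [map_smul, TupleFunction.boundary_single, toTupleFunction_single,
      Perm.viaFintypeEmbedding_sign, leg_mk]
    congr 2
    ext i
    rw [Fin.tail, Fin.tail, Tableau.firstColumn_smul]
    exact congrArg _ (Perm.viaFintypeEmbedding_apply_image ρ c i.succ).symm

/-- Compare spanning sets: injective tuples are the first columns of tableaux, and the other tuples
antisymmetrize to zero. -/
theorem map_toTupleFunction_spechtSubrepresentation (hn : a + b + 1 = n) :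
    (spechtSubrepresentation (hookDiagram a b) n).toSubmodule.map (toTupleFunction a b n) =
      TupleFunction.boundaries (Fin n) b := by
  refine le_antisymm ?_ ?_
  · rw [spechtSubrepresentation, Submodule.map_span_le]
    rintro _ ⟨T, rfl⟩
    rw [toTupleFunction_polytabloid]
    exact ⟨_, rfl⟩
  · rw [TupleFunction.boundaries, LinearMap.range_eq_map, ← (Pi.basisFun ℚ _).span_eq,
      Submodule.map_span_le]
    rintro _ ⟨c, rfl⟩
    rw [Pi.basisFun_apply, LinearMap.comp_apply]
    by_cases hc : Function.Injective c
    · obtain ⟨T, rfl⟩ := Tableau.exists_firstColumn_eq hn hc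
      rw [← toTupleFunction_polytabloid]
      exact Submodule.mem_map_of_mem (Submodule.subset_span ⟨T, rfl⟩)
    · rw [TupleFunction.alternation_single_of_not_injective hc, map_zero]
      exact zero_mem _

end Tabloid

theorem character_irreducibleRep_hookDiagram {a b n : ℕ} (hn : a + b + 1 = n) (σ : Perm (Fin n)) :
    (irreducibleRep (hookDiagram a b) n).character σ = TupleFunction.boundariesTrace b σ := by
  let e := (Submodule.equivMapOfInjective _ Tabloid.toTupleFunction_injective
    (spechtSubrepresentation (hookDiagram a b) n).toSubmodule).trans
      (LinearEquiv.ofEq _ _ (Tabloid.map_toTupleFunction_spechtSubrepresentation hn))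
  change LinearMap.trace ℚ _ ((spechtSubrepresentation (hookDiagram a b) n).toRepresentation σ) = _
  rw [← LinearMap.trace_conj' _ e, TupleFunction.boundariesTrace]
  congr 1
  refine LinearMap.ext fun φ => ?_
  obtain ⟨v, rfl⟩ := e.surjective φ
  rw [LinearEquiv.conj_apply_apply, LinearEquiv.symm_apply_apply]
  exact Subtype.ext (Tabloid.toTupleFunction_tabloidModule σ v.1)

/-! ## Cycle types of permutations -/

namespace CycleType

variable {α β γ : Type*}

theorem mem_range_or_mem_range {c : β ↪ α} {d : γ ↪ α}
    (h : IsCompl (Set.range c) (Set.range d)) (y : α) : (∃ i, c i = y) ∨ ∃ i, d i = y := by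
  have : y ∈ Set.range c ⊔ Set.range d := by rw [h.sup_eq_top]; trivial
  exact this

theorem sum_sign_ite_eq_zero [Fintype β] [DecidableEq β] {x : β → α}
    (hx : ¬ Function.Injective x) (σ : Perm α)
    [DecidablePred fun ρ : Perm β => ∀ i, σ (x i) = x (ρ i)] :
    (∑ ρ : Perm β, if ∀ i, σ (x i) = x (ρ i) then ((Perm.sign ρ : ℤ) : ℚ) else 0) = 0 := by
  rw [Function.not_injective_iff] at hx
  obtain ⟨i, j, hij, hne⟩ := hx
  have hswap : ∀ k, x (swap i j k) = x k := by
    intro k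
    rw [swap_apply_def]
    split_ifs with h1 h2
    · rw [h1, hij]
    · rw [h2, hij]
    · rfl
  refine self_eq_neg.1 ?_
  conv_lhs => rw [← Equiv.sum_comp (Equiv.mulLeft (swap i j))]
  rw [← Finset.sum_neg_distrib]
  refine Finset.sum_congr rfl fun ρ _ => ?_
  simp only [Equiv.coe_mulLeft, Perm.mul_apply, hswap, Perm.sign_mul, Perm.sign_swap hne]
  split_ifs <;> simp

variable [DecidableEq α] [Fintype β] [Fintype γ]

/-- The permutation that acts as `ρ` on the image of `c` and as `τ` on the image of `d`. -/
def glue (c : β ↪ α) (d : γ ↪ α) (ρ : Perm β) (τ : Perm γ) : Perm α :=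
  ρ.viaFintypeEmbedding c * τ.viaFintypeEmbedding d

theorem glue_apply_left {c : β ↪ α} {d : γ ↪ α}
    (h : IsCompl (Set.range c) (Set.range d)) (ρ : Perm β) (τ : Perm γ) (i : β) :
    glue c d ρ τ (c i) = c (ρ i) := by
  have hi : c i ∉ Set.range d := fun hi => Set.disjoint_left.1 h.disjoint ⟨i, rfl⟩ hi
  rw [glue, Perm.mul_apply, Perm.viaFintypeEmbedding_apply_notMem_range _ _ hi,
    Perm.viaFintypeEmbedding_apply_image]

theorem glue_apply_right {c : β ↪ α} {d : γ ↪ α}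
    (h : IsCompl (Set.range c) (Set.range d)) (ρ : Perm β) (τ : Perm γ) (i : γ) :
    glue c d ρ τ (d i) = d (τ i) := by
  rw [glue, Perm.mul_apply, Perm.viaFintypeEmbedding_apply_image,
    Perm.viaFintypeEmbedding_apply_notMem_range]
  exact fun hi => Set.disjoint_left.1 h.disjoint hi ⟨_, rfl⟩

/-- Once `σ` is prescribed on the image of `c`, it preserves the complement, where it may be any
permutation. -/
theorem sum_ite_semiconj [Fintype α] [DecidableEq γ] {M : Type*} [AddCommMonoid M]
    {c : β ↪ α} {d : γ ↪ α}
    (h : IsCompl (Set.range c) (Set.range d))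
    (ρ : Perm β) (f : Perm α → M)
    [DecidablePred fun σ : Perm α => ∀ i, σ (c i) = c (ρ i)] :
    (∑ σ : Perm α, if ∀ i, σ (c i) = c (ρ i) then f σ else 0) =
      ∑ τ : Perm γ, f (glue c d ρ τ) := by
  rw [← Finset.sum_filter]
  symm
  refine Finset.sum_bij (fun τ _ => glue c d ρ τ) (fun τ _ => ?_) (fun τ _ τ' _ hτ => ?_)
    (fun σ hσ => ?_) (fun τ _ => rfl)
  · rw [Finset.mem_filter_univ]
    exact glue_apply_left h ρ τ
  · ext1 i
    apply d.injective
    rw [← glue_apply_right h ρ τ, hτ, glue_apply_right h]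
  · rw [Finset.mem_filter_univ] at hσ
    have hd : ∀ i, ∃ j, d j = σ (d i) := fun i => by
      rcases mem_range_or_mem_range h (σ (d i)) with ⟨j, hj⟩ | hj
      · exfalso
        have h1 := hσ (ρ⁻¹ j)
        rw [show ρ (ρ⁻¹ j) = j from ρ.apply_symm_apply j, hj] at h1
        exact Set.disjoint_left.1 h.disjoint ⟨_, σ.injective h1⟩ ⟨i, rfl⟩
      · exact hj
    choose τ hτ using hd
    have hinj : Function.Injective τ := fun i j hij =>
      d.injective (σ.injective (by rw [← hτ, ← hτ, hij]))
    refine ⟨Equiv.ofBijective τ (Finite.injective_iff_bijective.1 hinj), Finset.mem_univ _, ?_⟩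
    ext1 y
    rcases mem_range_or_mem_range h y with ⟨i, rfl⟩ | ⟨i, rfl⟩
    · rw [glue_apply_left h, hσ]
    · rw [glue_apply_right h, ← hτ]
      rfl

variable [Fintype α] [DecidableEq β] [DecidableEq γ]

/-- The exponents of the variables `p_j` in the monomial of a permutation: the exponent of `p_j`
is the number of cycles of length `j`. -/
def exponents (σ : Perm α) : ℕ+ →₀ ℕ :=
  (Multiset.toFinsupp σ.partition.parts).comapDomain PNat.val PNat.coe_injective.injOn

theorem exponents_apply (σ : Perm α) (j : ℕ+) :
    exponents σ j = σ.partition.parts.count (j : ℕ) := rfl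

theorem parts_partition_eq (σ : Perm α) : σ.partition.parts =
    σ.cycleType + Multiset.replicate (Fintype.card α - σ.cycleType.sum) 1 := by
  rw [Perm.parts_partition, Perm.sum_cycleType]

theorem exponents_add {σ : Perm α} {ρ : Perm β} {τ : Perm γ}
    (hcard : Fintype.card α = Fintype.card β + Fintype.card γ)
    (h : σ.cycleType = ρ.cycleType + τ.cycleType) : exponents σ = exponents ρ + exponents τ := by
  have : σ.partition.parts = ρ.partition.parts + τ.partition.parts := by
    have h1 := ρ.sum_cycleType_le
    have h2 := τ.sum_cycleType_le
    rw [parts_partition_eq, parts_partition_eq, parts_partition_eq, h, Multiset.sum_add,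
      add_add_add_comm, ← Multiset.replicate_add]
    congr 2
    omega
  ext j
  rw [Finsupp.add_apply, exponents_apply, exponents_apply, exponents_apply, this,
    Multiset.count_add]

/-- The multiset of natural numbers that contains `i` with multiplicity `m i`. -/
def partsOfExponents (m : ℕ+ →₀ ℕ) : Multiset ℕ := (Finsupp.toMultiset m).map PNat.val

theorem count_partsOfExponents (m : ℕ+ →₀ ℕ) (i : ℕ+) :
    (partsOfExponents m).count (i : ℕ) = m i := by
  rw [partsOfExponents, Multiset.count_map_eq_count' _ _ PNat.coe_injective,
    Finsupp.count_toMultiset]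

theorem pos_of_mem_partsOfExponents {m : ℕ+ →₀ ℕ} {i : ℕ} (h : i ∈ partsOfExponents m) :
    0 < i := by
  obtain ⟨j, -, rfl⟩ := Multiset.mem_map.1 h
  exact j.pos

theorem exponents_eq_iff (σ : Perm α) (m : ℕ+ →₀ ℕ) :
    exponents σ = m ↔ σ.partition.parts = partsOfExponents m := by
  rw [DFunLike.ext_iff, Multiset.ext]
  constructor
  · intro h i
    rcases Nat.eq_zero_or_pos i with rfl | hi
    · rw [Multiset.count_eq_zero_of_notMem, Multiset.count_eq_zero_of_notMem]
      · exact fun h => (pos_of_mem_partsOfExponents h).ne rfl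
      · exact fun h => (σ.partition.parts_pos h).ne rfl
    · exact (h ⟨i, hi⟩).trans (count_partsOfExponents m ⟨i, hi⟩).symm
  · intro h i
    rw [exponents_apply, h, count_partsOfExponents]

theorem sum_partsOfExponents (m : ℕ+ →₀ ℕ) :
    (partsOfExponents m).sum = CycleIndexRing.cardinalityDegree m := by
  rw [CycleIndexRing.cardinalityDegree]
  induction m using Finsupp.induction_linear with
  | zero => simp [partsOfExponents]
  | add f g hf hg =>
    rw [map_add, ← hf, ← hg, partsOfExponents, map_add, Multiset.map_add, Multiset.sum_add]
    rfl
  | single i c =>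
    simp [partsOfExponents, Finsupp.weight_single, Multiset.map_nsmul, Multiset.sum_nsmul]

theorem weight_exponents (σ : Perm α) :
    CycleIndexRing.cardinalityDegree (exponents σ) = Fintype.card α := by
  rw [← sum_partsOfExponents, ← (exponents_eq_iff σ _).1 rfl, σ.partition.parts_sum]

theorem partsOfExponents_eq (m : ℕ+ →₀ ℕ) : partsOfExponents m =
    (partsOfExponents m).filter (2 ≤ ·) + Multiset.replicate (m 1) 1 := by
  conv_lhs => rw [← Multiset.filter_add_not (2 ≤ ·) (partsOfExponents m)]
  congr 1
  rw [← count_partsOfExponents, PNat.one_coe, ← Multiset.filter_eq']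
  refine Multiset.filter_congr fun i hi => ?_
  have := pos_of_mem_partsOfExponents hi
  omega

/-- `cycleType` omits fixed points, but the total size recovers their number. -/
theorem exponents_eq_iff_cycleType_eq (σ : Perm α) {m : ℕ+ →₀ ℕ}
    (h : CycleIndexRing.cardinalityDegree m = Fintype.card α) :
    exponents σ = m ↔ σ.cycleType = (partsOfExponents m).filter (2 ≤ ·) := by
  rw [exponents_eq_iff]
  constructor
  · intro h'
    rw [← h', Perm.filter_parts_partition_eq_cycleType]
  · intro h'
    have h1 := sum_partsOfExponents m
    rw [partsOfExponents_eq, Multiset.sum_add, Multiset.sum_replicate, h, smul_eq_mul,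
      mul_one] at h1
    rw [parts_partition_eq, h', ← h1, Nat.add_sub_cancel_left, ← partsOfExponents_eq]

/-- The order of the centralizer of a permutation with `m i` cycles of length `i`. -/
def centralizerOrder (m : ℕ+ →₀ ℕ) : ℕ := m.prod fun i c => (i : ℕ) ^ c * c.factorial

theorem centralizerOrder_ne_zero (m : ℕ+ →₀ ℕ) : centralizerOrder m ≠ 0 :=
  Finset.prod_ne_zero_iff.2 fun i _ => mul_ne_zero (pow_ne_zero _ i.ne_zero)
    (Nat.factorial_ne_zero _)

theorem centralizerOrder_eq (m : ℕ+ →₀ ℕ) (i : ℕ+) : centralizerOrder m =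
    (i : ℕ) ^ m i * (m i).factorial * centralizerOrder (m.erase i) :=
  (Finsupp.mul_prod_erase' m i (fun i c => (i : ℕ) ^ c * c.factorial) (by simp)).symm

theorem centralizerOrder_sub_single {m : ℕ+ →₀ ℕ} {i : ℕ+} (h : m i ≠ 0) :
    centralizerOrder m = i * m i * centralizerOrder (m - Finsupp.single i 1) := by
  have h1 : (m - Finsupp.single i 1).erase i = m.erase i := by
    ext j
    rcases eq_or_ne j i with rfl | hj
    · simp
    · simp [Finsupp.erase_ne hj, Finsupp.single_eq_of_ne hj]
  obtain ⟨c, hc⟩ := Nat.exists_eq_succ_of_ne_zero h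
  rw [centralizerOrder_eq m i, centralizerOrder_eq (m - _) i, h1]
  simp only [Finsupp.tsub_apply, Finsupp.single_eq_same, hc, Nat.succ_eq_add_one,
    Nat.add_sub_cancel, Nat.factorial_succ, pow_succ]
  ring

/-- The size of a conjugacy class times the order of a centralizer. The library count handles fixed
points separately; they supply the factor at `i = 1`. -/
theorem card_exponents_eq_mul_centralizerOrder {m : ℕ+ →₀ ℕ}
    (h : CycleIndexRing.cardinalityDegree m = Fintype.card α) :
    (Finset.univ.filter fun σ : Perm α => exponents σ = m).card * centralizerOrder m =
      (Fintype.card α).factorial := by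
  have h1 := sum_partsOfExponents m
  rw [partsOfExponents_eq, Multiset.sum_add, Multiset.sum_replicate, h, smul_eq_mul,
    mul_one] at h1
  set ct := (partsOfExponents m).filter (2 ≤ ·) with hct
  have key := Perm.card_of_cycleType_mul_eq α ct
  rw [if_pos ⟨by omega, fun a ha => (Multiset.mem_filter.1 ha).2⟩, ← h1,
    Nat.add_sub_cancel_left] at key
  rw [← h1, ← key]
  congr 1
  · simp only [exponents_eq_iff_cycleType_eq _ h, ← hct]
  · rw [centralizerOrder_eq m 1, mul_assoc, Finset.prod_multiset_count, mul_assoc,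
      ← Finset.prod_mul_distrib]
    have hsupp : ct.toFinset = (m.erase 1).support.map ⟨PNat.val, PNat.coe_injective⟩ := by
      ext i
      rw [hct, Multiset.mem_toFinset, Multiset.mem_filter, Finset.mem_map]
      constructor
      · rintro ⟨hi, hi2⟩
        obtain ⟨j, hj, rfl⟩ := Multiset.mem_map.1 hi
        refine ⟨j, ?_, rfl⟩
        rw [Finsupp.support_erase, Finset.mem_erase]
        refine ⟨fun h => ?_, by simpa using hj⟩
        rw [h] at hi2
        simp at hi2
      · rintro ⟨j, hj, rfl⟩
        rw [Finsupp.support_erase, Finset.mem_erase] at hj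
        refine ⟨Multiset.mem_map.2 ⟨j, by simpa using hj.2, rfl⟩, ?_⟩
        have := j.pos
        have h2 : (j : ℕ) ≠ 1 := fun h => hj.1 (PNat.coe_injective h)
        simp only [Function.Embedding.coeFn_mk]
        change 2 ≤ (j : ℕ)
        omega
    rw [hsupp, Finset.prod_map, PNat.one_coe, one_pow, one_mul, centralizerOrder, Finsupp.prod]
    congr 1
    refine Finset.prod_congr rfl fun i hi => ?_
    rw [Finsupp.support_erase, Finset.mem_erase] at hi
    have h2 : 2 ≤ (i : ℕ) := by
      have := i.pos
      have h2 : (i : ℕ) ≠ 1 := fun h => hi.1 (PNat.coe_injective h)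
      omega
    have h3 : ct.count (i : ℕ) = m i := by
      rw [hct, Multiset.count_filter_of_pos h2, count_partsOfExponents]
    rw [Finsupp.erase_ne hi.1, ← h3]
    rfl

/-- A cycle of length `l` has sign `(-1)^(l-1)`, so `(-1)^l` times it leaves one factor `-1` per
cycle. -/
theorem neg_one_pow_card_mul_sign (σ : Perm α) :
    (-1 : ℚ) ^ Fintype.card α * ((Perm.sign σ : ℤ) : ℚ) = (-1) ^ (exponents σ).degree := by
  have h1 : (exponents σ).degree = σ.partition.parts.card := by
    rw [(exponents_eq_iff σ _).1 rfl, partsOfExponents, Multiset.card_map,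
      Finsupp.card_toMultiset]
    rfl
  have h2 := σ.sum_cycleType_le
  obtain ⟨c, hc⟩ := Nat.exists_eq_add_of_le h2
  rw [h1, parts_partition_eq, Multiset.card_add, Multiset.card_replicate, hc,
    Nat.add_sub_cancel_left, Perm.sign_of_cycleType]
  push_cast
  rw [← pow_add]
  have : σ.cycleType.sum + c + (σ.cycleType.sum + σ.cycleType.card) =
    2 * σ.cycleType.sum + (σ.cycleType.card + c) := by ring
  rw [this, pow_add, pow_mul, neg_one_sq, one_pow, one_mul]

theorem exponents_glue {c : β ↪ α} {d : γ ↪ α}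
    (h : IsCompl (Set.range c) (Set.range d)) (ρ : Perm β) (τ : Perm γ) :
    exponents (glue c d ρ τ) = exponents ρ + exponents τ := by
  refine exponents_add ?_ ?_
  · rw [← Fintype.card_sum]
    refine (Fintype.card_of_bijective (f := Sum.elim c d) ⟨?_, ?_⟩).symm
    · exact c.injective.sumElim d.injective fun i j hij =>
        Set.disjoint_left.1 h.disjoint ⟨i, rfl⟩ ⟨j, hij.symm⟩
    · intro y
      rcases mem_range_or_mem_range h y with ⟨i, hi⟩ | ⟨i, hi⟩
      · exact ⟨Sum.inl i, hi⟩
      · exact ⟨Sum.inr i, hi⟩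
  · rw [glue, Perm.Disjoint.cycleType_mul, Perm.viaFintypeEmbedding, Perm.viaFintypeEmbedding,
      Perm.cycleType_extendDomain, Perm.cycleType_extendDomain]
    intro y
    rcases mem_range_or_mem_range h y with ⟨i, hi⟩ | ⟨i, hi⟩
    · exact Or.inr (Perm.viaFintypeEmbedding_apply_notMem_range _ _
        fun hy => Set.disjoint_left.1 h.disjoint ⟨i, hi⟩ hy)
    · exact Or.inl (Perm.viaFintypeEmbedding_apply_notMem_range _ _
        fun hy => Set.disjoint_left.1 h.disjoint hy ⟨i, hi⟩)

/-- The cycle index series of the trivial representation. -/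
def trivialSeries (n : ℕ) : CycleIndexRing :=
  (n.factorial : ℚ)⁻¹ • ∑ σ : Perm (Fin n), MvPowerSeries.monomial (exponents σ) 1

/-- The cycle index series of the sign representation. -/
def signSeries (n : ℕ) : CycleIndexRing :=
  (n.factorial : ℚ)⁻¹ • ∑ σ : Perm (Fin n),
    ((Perm.sign σ : ℤ) : ℚ) • MvPowerSeries.monomial (exponents σ) 1

/-- Frobenius characteristic of a representation induced from `Σ_j × Σ_(n-j)`. Fix an injective
tuple: the permutations preserving its image split as pairs, giving the product of the two series.
The number of such tuples, `n!/(n-j)!`, cancels the normalizations. -/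
theorem sum_alternatingTrace_smul (n j : ℕ) :
    (n.factorial : ℚ)⁻¹ • ∑ σ : Perm (Fin n), TupleFunction.alternatingTrace j σ •
      (MvPowerSeries.monomial (exponents σ) 1 : CycleIndexRing) =
    if j ≤ n then signSeries j * trivialSeries (n - j) else 0 := by
  let S : (Fin j → Fin n) → CycleIndexRing := fun x => ∑ σ : Perm (Fin n),
    (∑ ρ : Perm (Fin j), if ∀ i, σ (x i) = x (ρ i) then ((Perm.sign ρ : ℤ) : ℚ) else 0) •
      (MvPowerSeries.monomial (exponents σ) 1 : CycleIndexRing)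
  have hS0 : ∀ x, ¬ Function.Injective x → S x = 0 := fun x hx =>
    Finset.sum_eq_zero fun σ _ => by rw [sum_sign_ite_eq_zero hx, zero_smul]
  have hS : ∀ x, Function.Injective x →
      S x = ((j.factorial : ℚ) * (n - j).factorial) • (signSeries j * trivialSeries (n - j)) := by
    intro x hx
    let c : Fin j ↪ Fin n := ⟨x, hx⟩
    have hcard : Fintype.card (Fin (n - j)) = Fintype.card {y // y ∈ (Set.range x)ᶜ} := by
      classical
      rw [Fintype.card_compl_set, Set.card_range_of_injective hx]
      simp
    let e : Fin (n - j) ≃ {y // y ∈ (Set.range x)ᶜ} := Fintype.equivOfCardEq hcard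
    let d : Fin (n - j) ↪ Fin n := e.toEmbedding.trans (Function.Embedding.subtype _)
    have hd : Set.range d = (Set.range c)ᶜ := by
      have : ⇑d = Subtype.val ∘ e := rfl
      rw [this, e.surjective.range_comp, Subtype.range_coe]
      rfl
    have h : IsCompl (Set.range c) (Set.range d) := hd ▸ isCompl_compl
    have h1 : S x = ∑ ρ : Perm (Fin j), ∑ σ : Perm (Fin n), if ∀ i, σ (c i) = c (ρ i) then
        ((Perm.sign ρ : ℤ) : ℚ) • (MvPowerSeries.monomial (exponents σ) 1 : CycleIndexRing)
        else 0 := by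
      rw [Finset.sum_comm]
      refine Finset.sum_congr rfl fun σ _ => ?_
      rw [Finset.sum_smul]
      refine Finset.sum_congr rfl fun ρ _ => ?_
      rw [ite_smul, zero_smul]
      rfl
    rw [h1, Finset.sum_congr rfl fun ρ _ => sum_ite_semiconj h ρ _, signSeries, trivialSeries,
      smul_mul_smul_comm, smul_smul, Finset.sum_mul_sum]
    rw [mul_mul_mul_comm, mul_inv_cancel₀ (by positivity), mul_inv_cancel₀ (by positivity),
      one_mul, one_smul]
    refine Finset.sum_congr rfl fun ρ _ => Finset.sum_congr rfl fun τ _ => ?_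
    rw [exponents_glue h, smul_mul_assoc, MvPowerSeries.monomial_mul_monomial, one_mul]
  have hsum : (n.factorial : ℚ)⁻¹ • ∑ σ : Perm (Fin n), TupleFunction.alternatingTrace j σ •
      (MvPowerSeries.monomial (exponents σ) 1 : CycleIndexRing) =
      ((n.factorial : ℚ)⁻¹ * (j.factorial : ℚ)⁻¹) • ∑ x : Fin j → Fin n, S x := by
    rw [← smul_smul, Finset.sum_comm,
      Finset.smul_sum (s := Finset.univ (α := Perm (Fin n))) (r := (j.factorial : ℚ)⁻¹)]
    congr 1
    refine Finset.sum_congr rfl fun σ _ => ?_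
    rw [TupleFunction.alternatingTrace_eq, mul_smul, Finset.sum_comm, Finset.sum_smul]
  rw [hsum]
  have hfilter : ∑ x : Fin j → Fin n, S x = (n.descFactorial j : ℚ) •
      ((j.factorial : ℚ) * (n - j).factorial) • (signSeries j * trivialSeries (n - j)) := by
    classical
    rw [← Finset.sum_filter_of_ne (p := Function.Injective)
      (fun x _ hx => not_imp_comm.1 (hS0 x) hx),
      Finset.sum_congr rfl fun x hx => hS x (Finset.mem_filter.1 hx).2, Finset.sum_const,
      ← Fintype.card_subtype, Fintype.card_congr (Equiv.subtypeInjectiveEquivEmbedding _ _),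
      Fintype.card_embedding_eq, Fintype.card_fin, Fintype.card_fin, Nat.cast_smul_eq_nsmul]
  rw [hfilter]
  split_ifs with hj
  · rw [smul_smul, smul_smul, ← Nat.factorial_mul_descFactorial hj]
    convert one_smul ℚ _
    have h1 : (n.descFactorial j : ℚ) ≠ 0 := by
      simpa [Nat.descFactorial_eq_zero_iff_lt] using hj
    push_cast
    field_simp
  · rw [Nat.descFactorial_eq_zero_iff_lt.2 (not_le.1 hj), Nat.cast_zero, zero_smul, smul_zero]

end CycleType

/-! ## Coefficients of cycle index series -/

namespace CycleIndexRing

theorem coeff_formalSum {ι : Type} (f : ι → CycleIndexRing) (m : ℕ+ →₀ ℕ) :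
    MvPowerSeries.coeff m (formalSum f) = ∑ᶠ i, MvPowerSeries.coeff m (f i) := rfl

theorem coeff_smul (c : ℚ) (f : CycleIndexRing) (m : ℕ+ →₀ ℕ) :
    MvPowerSeries.coeff m (c • f) = c • MvPowerSeries.coeff m f := rfl

theorem coeff_truncation (N : ℕ) (f : CycleIndexRing) (m : ℕ+ →₀ ℕ) :
    MvPowerSeries.coeff m (truncation N f) =
      if cardinalityDegree m ≤ N then MvPowerSeries.coeff m f else 0 := rfl

theorem coeff_powerSum_single (i : ℕ+) :
    MvPowerSeries.coeff (Finsupp.single i 1) powerSum = (i : ℚ)⁻¹ • (1 : Polynomial ℚ) := by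
  rw [powerSum, coeff_formalSum, finsum_eq_single _ i]
  · rw [CycleIndexRing.coeff_smul, p, MvPowerSeries.coeff_index_single_self_X]
  · intro j hj
    rw [CycleIndexRing.coeff_smul, p, MvPowerSeries.coeff_index_single_X, if_neg hj.symm, smul_zero]

theorem coeff_powerSum_of_ne {m : ℕ+ →₀ ℕ} (h : ∀ i, m ≠ Finsupp.single i 1) :
    MvPowerSeries.coeff m powerSum = 0 := by
  classical
  rw [powerSum, coeff_formalSum, finsum_eq_zero_of_forall_eq_zero]
  intro i
  rw [CycleIndexRing.coeff_smul, p, MvPowerSeries.coeff_X, if_neg (h i), smul_zero]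

theorem coeff_powerSum_mul (f : CycleIndexRing) (m : ℕ+ →₀ ℕ) :
    MvPowerSeries.coeff m (powerSum * f) = ∑ i ∈ m.support,
      (i : ℚ)⁻¹ • MvPowerSeries.coeff (m - Finsupp.single i 1) f := by
  classical
  rw [MvPowerSeries.coeff_mul]
  have hinj : Function.Injective fun i : ℕ+ => (Finsupp.single i 1, m - Finsupp.single i 1) :=
    fun i j h => Finsupp.single_left_injective one_ne_zero (Prod.ext_iff.1 h).1
  rw [← Finset.sum_subset (s₁ := m.support.image fun i =>
    (Finsupp.single i 1, m - Finsupp.single i 1)), Finset.sum_image hinj.injOn]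
  · refine Finset.sum_congr rfl fun i _ => ?_
    rw [coeff_powerSum_single, smul_mul_assoc, one_mul]
  · intro x hx
    obtain ⟨i, hi, rfl⟩ := Finset.mem_image.1 hx
    rw [Finset.HasAntidiagonal.mem_antidiagonal]
    refine add_tsub_cancel_of_le (Finsupp.single_le_iff.2 ?_)
    exact Nat.one_le_iff_ne_zero.2 (Finsupp.mem_support_iff.1 hi)
  · rintro ⟨u, v⟩ huv hx
    rw [Finset.HasAntidiagonal.mem_antidiagonal] at huv
    rw [coeff_powerSum_of_ne, zero_mul]
    rintro i rfl
    refine hx (Finset.mem_image.2 ⟨i, ?_, ?_⟩)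
    · simp [← huv]
    · simp [← huv]

/-- The multinomial theorem, by peeling off one factor: removing `p_i` divides the centralizer order
by `i * m i`, so the terms are proportional to `m i`, and these sum to the degree. -/
theorem coeff_powerSum_pow (d : ℕ) (m : ℕ+ →₀ ℕ) :
    MvPowerSeries.coeff m (powerSum ^ d) =
      if m.degree = d then ((d.factorial : ℚ) * (CycleType.centralizerOrder m : ℚ)⁻¹) • 1
      else 0 := by
  classical
  induction d generalizing m with
  | zero =>
    rw [pow_zero, MvPowerSeries.coeff_one]
    simp only [Finsupp.degree_eq_zero_iff]
    split_ifs with h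
    · simp [h, CycleType.centralizerOrder]
    · rfl
  | succ d ih =>
    rw [pow_succ', coeff_powerSum_mul]
    have h1 : ∀ i ∈ m.support, (m - Finsupp.single i 1).degree + 1 = m.degree := by
      intro i hi
      have : Finsupp.single i 1 ≤ m :=
        Finsupp.single_le_iff.2 (Nat.one_le_iff_ne_zero.2 (Finsupp.mem_support_iff.1 hi))
      conv_rhs => rw [← tsub_add_cancel_of_le this]
      simp
    have h2 : ∀ i ∈ m.support,
        (i : ℚ)⁻¹ • MvPowerSeries.coeff (m - Finsupp.single i 1) (powerSum ^ d) =
        if m.degree = d + 1 then ((m i : ℚ) *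
          ((d.factorial : ℚ) * (CycleType.centralizerOrder m : ℚ)⁻¹)) • 1 else 0 := by
      intro i hi
      have h3 := CycleType.centralizerOrder_sub_single (Finsupp.mem_support_iff.1 hi)
      rw [ih]
      by_cases h : m.degree = d + 1
      · rw [if_pos h, if_pos (by have := h1 i hi; omega), smul_smul, h3]
        congr 1
        have h4 : (m i : ℚ) ≠ 0 := by simpa using hi
        push_cast
        field_simp
      · rw [if_neg h, if_neg (by have := h1 i hi; omega), smul_zero]
    rw [Finset.sum_congr rfl h2]
    split_ifs with h
    · rw [← Finset.sum_smul, ← Finset.sum_mul, ← Nat.cast_sum]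
      have : ∑ i ∈ m.support, m i = d + 1 := h
      rw [this, Nat.factorial_succ]
      push_cast
      rw [mul_assoc]
    · rw [Finset.sum_const_zero]

theorem constantCoeff_powerSum : MvPowerSeries.constantCoeff powerSum = 0 := by
  rw [← MvPowerSeries.coeff_zero_eq_constantCoeff_apply, coeff_powerSum_of_ne]
  intro i h
  have := DFunLike.congr_fun h i
  simp at this

/-- Only the power equal to the number of cycles contributes, and its factorial cancels that of the
exponential. The scalar `c` serves both signs of the exponent. -/
theorem coeff_exp_smul_powerSum (c : ℚ) (m : ℕ+ →₀ ℕ) :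
    MvPowerSeries.coeff m (exp (c • powerSum)) =
      (c ^ m.degree * (CycleType.centralizerOrder m : ℚ)⁻¹) • 1 := by
  have hs : PowerSeries.HasSubst (c • powerSum) := by
    refine PowerSeries.HasSubst.of_constantCoeff_zero ?_
    rw [MvPowerSeries.constantCoeff_smul, constantCoeff_powerSum, smul_zero]
  rw [exp, PowerSeries.coeff_subst hs, finsum_eq_single _ m.degree]
  · rw [PowerSeries.coeff_exp, smul_pow, CycleIndexRing.coeff_smul, coeff_powerSum_pow, if_pos rfl,
      smul_smul, smul_smul]
    congr 1
    have : (m.degree.factorial : ℚ) ≠ 0 := by positivity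
    simp
    field_simp
  · intro d hd
    rw [smul_pow, CycleIndexRing.coeff_smul, coeff_powerSum_pow, if_neg hd.symm, smul_zero,
      smul_zero]

end CycleIndexRing

/-! ### Trivial and sign series as homogeneous parts of exponentials -/

namespace CycleType

theorem coeff_trivialSeries (n : ℕ) (m : ℕ+ →₀ ℕ) :
    MvPowerSeries.coeff m (trivialSeries n) = if CycleIndexRing.cardinalityDegree m = n then
      MvPowerSeries.coeff m (CycleIndexRing.exp CycleIndexRing.powerSum) else 0 := by
  classical
  rw [trivialSeries, CycleIndexRing.coeff_smul, map_sum]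
  simp only [MvPowerSeries.coeff_monomial]
  split_ifs with h
  · have h1 := CycleIndexRing.coeff_exp_smul_powerSum 1 m
    rw [one_smul] at h1
    rw [h1]
    have h2 := card_exponents_eq_mul_centralizerOrder (α := Fin n) (m := m) (by simpa using h)
    rw [Fintype.card_fin] at h2
    simp only [eq_comm (a := m)]
    rw [← Finset.sum_filter, Finset.sum_const, ← h2, ← Nat.cast_smul_eq_nsmul ℚ, smul_smul]
    congr 1
    have h3 := centralizerOrder_ne_zero m
    have h4 := Nat.factorial_ne_zero n
    rw [← h2] at h4
    have h5 := left_ne_zero_of_mul h4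
    push_cast
    field_simp
    simp
  · rw [Finset.sum_eq_zero, smul_zero]
    intro σ _
    rw [if_neg]
    rintro rfl
    exact h (by rw [weight_exponents, Fintype.card_fin])

theorem coeff_signSeries (n : ℕ) (m : ℕ+ →₀ ℕ) :
    (-1) ^ n * MvPowerSeries.coeff m (signSeries n) =
      if CycleIndexRing.cardinalityDegree m = n then
        MvPowerSeries.coeff m (CycleIndexRing.exp (-CycleIndexRing.powerSum)) else 0 := by
  classical
  have h0 : (-1 : Polynomial ℚ) ^ n * MvPowerSeries.coeff m (signSeries n) =
      (-1 : ℚ) ^ m.degree • MvPowerSeries.coeff m (trivialSeries n) := by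
    rw [signSeries, trivialSeries, CycleIndexRing.coeff_smul, CycleIndexRing.coeff_smul, map_sum,
      map_sum, mul_smul_comm,
      smul_comm ((-1 : ℚ) ^ m.degree), Finset.mul_sum,
      Finset.smul_sum (r := (-1 : ℚ) ^ m.degree)]
    congr 1
    refine Finset.sum_congr rfl fun σ _ => ?_
    rw [CycleIndexRing.coeff_smul, MvPowerSeries.coeff_monomial]
    split_ifs with h
    · rw [h, ← neg_one_pow_card_mul_sign, Fintype.card_fin, mul_smul]
      simp [Algebra.smul_def]
    · simp
  rw [h0, coeff_trivialSeries]
  split_ifs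
  · have h1 := CycleIndexRing.coeff_exp_smul_powerSum 1 m
    have h2 := CycleIndexRing.coeff_exp_smul_powerSum (-1) m
    rw [one_smul] at h1
    rw [neg_one_smul] at h2
    rw [h1, h2, smul_smul, one_pow, one_mul]
  · rw [smul_zero]

/-- Sort the factorizations of the monomial by the cardinality degree `j` of the left factor; the
degree of the right factor is then forced. -/
theorem coeff_truncation_exp_mul_exp (N : ℕ) (m : ℕ+ →₀ ℕ) :
    MvPowerSeries.coeff m (CycleIndexRing.truncation N
      (CycleIndexRing.exp (-CycleIndexRing.powerSum)) *
        CycleIndexRing.exp CycleIndexRing.powerSum) =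
    ∑ j ∈ Finset.range (N + 1), (-1) ^ j * MvPowerSeries.coeff m
      (if j ≤ CycleIndexRing.cardinalityDegree m then
        signSeries j * trivialSeries (CycleIndexRing.cardinalityDegree m - j) else 0) := by
  classical
  have h1 : ∀ j, (-1) ^ j * MvPowerSeries.coeff m
      (if j ≤ CycleIndexRing.cardinalityDegree m then
        signSeries j * trivialSeries (CycleIndexRing.cardinalityDegree m - j) else 0) =
      ∑ x ∈ Finset.HasAntidiagonal.antidiagonal m, if CycleIndexRing.cardinalityDegree x.1 = j then
        MvPowerSeries.coeff x.1 (CycleIndexRing.exp (-CycleIndexRing.powerSum)) *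
          MvPowerSeries.coeff x.2 (CycleIndexRing.exp CycleIndexRing.powerSum) else 0 := by
    intro j
    have hdeg : ∀ x ∈ Finset.HasAntidiagonal.antidiagonal m, CycleIndexRing.cardinalityDegree m =
        CycleIndexRing.cardinalityDegree x.1 + CycleIndexRing.cardinalityDegree x.2 := by
      intro x hx
      rw [← Finset.HasAntidiagonal.mem_antidiagonal.1 hx, CycleIndexRing.cardinalityDegree, map_add]
      rfl
    split_ifs with hj
    · rw [MvPowerSeries.coeff_mul, Finset.mul_sum]
      refine Finset.sum_congr rfl fun x hx => ?_
      rw [← mul_assoc, coeff_signSeries, coeff_trivialSeries, ite_mul, zero_mul]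
      split_ifs with _ h2
      · rfl
      · exact absurd (by have := hdeg x hx; omega) h2
      · rfl
    · rw [map_zero, mul_zero, Finset.sum_eq_zero]
      intro x hx
      rw [if_neg]
      have := hdeg x hx
      omega
  rw [Finset.sum_congr rfl fun j _ => h1 j, Finset.sum_comm, MvPowerSeries.coeff_mul]
  refine Finset.sum_congr rfl fun x _ => ?_
  rw [Finset.sum_ite_eq, CycleIndexRing.coeff_truncation, ite_mul, zero_mul]
  simp only [Finset.mem_range, Nat.lt_succ_iff]

end CycleType

/-! ### Graded traces and assembly of the formula -/

namespace GradedRep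

variable {n : ℕ}

theorem character_zeroRep (σ : Perm (Fin n)) : (zeroRep n).character σ = 0 := by
  have : Subsingleton (zeroRep n) := inferInstanceAs (Subsingleton PUnit.{1})
  rw [FDRep.character, Subsingleton.elim ((zeroRep n).ρ σ) 0, map_zero]

theorem character_eq_zero_of_notMem (V : GradedRep n) {d : ℕ} (h : d ∉ V.finite_support.toFinset)
    (σ : Perm (Fin n)) : (V.component d).character σ = 0 := by
  rw [Set.Finite.mem_toFinset, Set.mem_ofPred_eq, not_nontrivial_iff_subsingleton] at h
  rw [FDRep.character, Subsingleton.elim ((V.component d).ρ σ) 0, map_zero]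

theorem coeff_gradedTrace (V : GradedRep n) (σ : Perm (Fin n)) (d : ℕ) :
    (V.gradedTrace σ).coeff d = (V.component d).character σ := by
  rw [gradedTrace, Polynomial.finsetSum_coeff]
  simp only [Polynomial.coeff_monomial, Finset.sum_ite_eq']
  split_ifs with h
  · rfl
  · exact (V.character_eq_zero_of_notMem h σ).symm

theorem gradedTrace_suspension_ofRep (V : FDRep ℚ (Perm (Fin n))) (m : ℕ) (σ : Perm (Fin n)) :
    ((ofRep V).suspension m).gradedTrace σ = Polynomial.monomial m (V.character σ) := by
  ext d
  rw [coeff_gradedTrace, Polynomial.coeff_monomial]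
  by_cases h : m = d
  · rw [if_pos h]
    simp [suspension, ofRep, h]
  · rw [if_neg h]
    by_cases hd : m ≤ d
    · have : d - m ≠ 0 := by omega
      simp [suspension, ofRep, hd, this, character_zeroRep]
    · simp [suspension, hd, character_zeroRep]

theorem gradedTrace_zero (σ : Perm (Fin n)) : (zero n).gradedTrace σ = 0 := by
  ext d
  rw [coeff_gradedTrace, Polynomial.coeff_zero, zero]
  change (if d = 0 then zeroRep n else zeroRep n).character σ = 0
  rw [ite_self, character_zeroRep]

end GradedRep

theorem CycleType.prod_p_pow_cycleCount {n : ℕ} (σ : Perm (Fin n)) :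
    ∏ j ∈ Finset.range n, CycleIndexRing.p j.succPNat ^ cycleCount (j + 1) σ =
      MvPowerSeries.monomial (exponents σ) 1 := by
  classical
  have h : exponents σ =
      ∑ j ∈ Finset.range n, Finsupp.single j.succPNat (cycleCount (j + 1) σ) := by
    ext i
    obtain ⟨j, rfl⟩ : ∃ j : ℕ, i = j.succPNat := ⟨i.natPred, by simp⟩
    rw [Finsupp.finsetSum_apply]
    simp only [Finsupp.single_apply, Nat.succPNat_inj, Finset.sum_ite_eq', Finset.mem_range]
    split_ifs with hj
    · rfl
    · rw [exponents_apply, Multiset.count_eq_zero]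
      intro hmem
      have := σ.partition.le_of_mem_parts hmem
      rw [Fintype.card_fin, Nat.succPNat_coe] at this
      omega
  rw [h]
  simp only [CycleIndexRing.p, MvPowerSeries.X_pow_eq]
  induction Finset.range n using Finset.induction_on with
  | empty => simp
  | insert a s ha ih =>
    rw [Finset.prod_insert ha, Finset.sum_insert ha, ih, MvPowerSeries.monomial_mul_monomial,
      one_mul]

theorem GradedRep.coeff_cycleIndexSum {n : ℕ} (V : GradedRep n) (m : ℕ+ →₀ ℕ) :
    MvPowerSeries.coeff m V.cycleIndexSum = (n.factorial : ℚ)⁻¹ • ∑ σ : Perm (Fin n),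
      V.gradedTrace σ *
        MvPowerSeries.coeff m (MvPowerSeries.monomial (CycleType.exponents σ) 1) := by
  rw [cycleIndexSum, CycleIndexRing.coeff_smul, map_sum]
  simp only [CycleType.prod_p_pow_cycleCount, MvPowerSeries.coeff_C_mul]

theorem GradedRep.coeff_cycleIndexSum_of_ne {n : ℕ} (V : GradedRep n) {m : ℕ+ →₀ ℕ}
    (h : CycleIndexRing.cardinalityDegree m ≠ n) : MvPowerSeries.coeff m V.cycleIndexSum = 0 := by
  classical
  rw [coeff_cycleIndexSum, Finset.sum_eq_zero, smul_zero]
  intro σ _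
  rw [MvPowerSeries.coeff_monomial, if_neg, mul_zero]
  rintro rfl
  exact h (by rw [CycleType.weight_exponents, Fintype.card_fin])

theorem SymmetricSequence.coeff_cycleIndexSum (M : SymmetricSequence) (m : ℕ+ →₀ ℕ) :
    MvPowerSeries.coeff m M.cycleIndexSum = MvPowerSeries.coeff m
      (M (CycleIndexRing.cardinalityDegree m)).cycleIndexSum := by
  rw [SymmetricSequence.cycleIndexSum, CycleIndexRing.coeff_formalSum,
    finsum_eq_single _ (CycleIndexRing.cardinalityDegree m)]
  exact fun n hn => (M n).coeff_cycleIndexSum_of_ne hn.symm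

/-- One formula covers all arities: for `n < k` the hook sequence is zero by definition, and so are
the boundaries, since `n ≤ k - 1`. -/
theorem gradedTrace_hookSequence {k n : ℕ} (hk : 2 ≤ k) (σ : Perm (Fin n)) :
    (hookSequence k n).gradedTrace σ =
      Polynomial.monomial (k - 2) (TupleFunction.boundariesTrace (k - 1) σ) := by
  rw [hookSequence]
  split_ifs with h
  · rw [GradedRep.gradedTrace_suspension_ofRep,
      character_irreducibleRep_hookDiagram (by omega : n - k + (k - 1) + 1 = n)]
  · rw [GradedRep.gradedTrace_zero, TupleFunction.boundariesTrace_eq_zero, map_zero]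
    rw [Fintype.card_fin]
    omega

theorem gradedTrace_hookSequence_eq_sum {k n : ℕ} (hk : 2 ≤ k) (hn : n ≠ 0) (σ : Perm (Fin n)) :
    (hookSequence k n).gradedTrace σ = -(-Polynomial.X) ^ (k - 2) *
      ∑ j ∈ Finset.range (k - 1 + 1), (-1) ^ j *
        Polynomial.C (TupleFunction.alternatingTrace j σ) := by
  have : Nonempty (Fin n) := ⟨⟨0, Nat.pos_of_ne_zero hn⟩⟩
  have h := TupleFunction.neg_one_pow_mul_boundariesTrace (k - 1) σ
  have h1 : ∑ j ∈ Finset.range (k - 1 + 1), (-1) ^ j *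
      Polynomial.C (TupleFunction.alternatingTrace j σ) = Polynomial.C
        ((-1) ^ (k - 1) * TupleFunction.boundariesTrace (k - 1) σ) := by
    rw [h, map_sum]
    simp
  obtain ⟨l, rfl⟩ := Nat.exists_eq_add_of_le' hk
  rw [gradedTrace_hookSequence hk, h1, ← Polynomial.C_mul_X_pow_eq_monomial, neg_pow]
  simp only [Nat.add_sub_cancel, map_mul, map_pow, map_neg, map_one,
    show l + 2 - 1 = l + 1 from rfl, pow_succ]
  have h2 : ((-1 : Polynomial ℚ) ^ l) * (-1) ^ l = 1 := by
    rw [← mul_pow]; simp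
  -- With `k = l + 2`, the sign `(-1)^(l+1)` of the alternating sum and `-(-1)^l` from `-(-q)^l`
  -- multiply to `1`.
  linear_combination
    (-(Polynomial.C (TupleFunction.boundariesTrace (l + 1) σ) * Polynomial.X ^ l)) * h2

theorem coeff_cycleIndexSum_hookSequence {k : ℕ} (hk : 2 ≤ k) {m : ℕ+ →₀ ℕ} (hm : m ≠ 0) :
    MvPowerSeries.coeff m (hookSequence k).cycleIndexSum = -(-Polynomial.X) ^ (k - 2) *
      MvPowerSeries.coeff m (CycleIndexRing.truncation (k - 1)
        (CycleIndexRing.exp (-CycleIndexRing.powerSum)) *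
          CycleIndexRing.exp CycleIndexRing.powerSum) := by
  -- A nontrivial monomial has positive arity, which the trace recursion requires because it divides
  -- by `n`.
  have hn : CycleIndexRing.cardinalityDegree m ≠ 0 := by
    have : Finsupp.NonTorsionWeight ℕ fun i : ℕ+ => (i : ℕ) :=
      Finsupp.nonTorsionWeight_of ℕ _ fun i => i.ne_zero
    rw [CycleIndexRing.cardinalityDegree, Ne, Finsupp.weight_eq_zero_iff_eq_zero]
    exact hm
  rw [SymmetricSequence.coeff_cycleIndexSum, GradedRep.coeff_cycleIndexSum,
    CycleType.coeff_truncation_exp_mul_exp]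
  simp only [gradedTrace_hookSequence_eq_sum hk hn, ← CycleType.sum_alternatingTrace_smul,
    CycleIndexRing.coeff_smul, map_sum]
  simp only [mul_smul_comm, mul_assoc, ← Finset.mul_sum, ← Finset.smul_sum, Finset.sum_mul]
  rw [Finset.sum_comm]
  simp only [← Finset.mul_sum, Polynomial.C_mul']

theorem proposition3p1 (k : ℕ) (hk : 2 ≤ k) :
    SymmetricSequence.cycleIndexSum (hookSequence k) =
      (-CycleIndexRing.q) ^ (k - 2) -
        (-CycleIndexRing.q) ^ (k - 2) *
          CycleIndexRing.truncation (k - 1) (CycleIndexRing.exp (-CycleIndexRing.powerSum)) *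
          CycleIndexRing.exp CycleIndexRing.powerSum := by
  classical
  have hq : (-CycleIndexRing.q) ^ (k - 2) = MvPowerSeries.C ((-Polynomial.X) ^ (k - 2)) := by
    rw [map_pow, map_neg]
    rfl
  ext1 m
  rw [hq, mul_assoc, map_sub, MvPowerSeries.coeff_C_mul, MvPowerSeries.coeff_C]
  split_ifs with h
  -- Constant term: both exponentials contribute `1`, so the right side cancels; on the left, arity
  -- `0` carries no boundaries.
  · subst h
    have h1 : ∀ c : ℚ, MvPowerSeries.coeff 0 (CycleIndexRing.exp (c • CycleIndexRing.powerSum)) =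
        1 := fun c => by
      rw [CycleIndexRing.coeff_exp_smul_powerSum]
      simp [CycleType.centralizerOrder]
    have h2 := h1 1
    have h3 := h1 (-1)
    rw [one_smul] at h2
    rw [neg_one_smul] at h3
    have h0 : CycleIndexRing.cardinalityDegree 0 = 0 := map_zero _
    have hmul : ∀ f g : CycleIndexRing, MvPowerSeries.coeff 0 (f * g) =
        MvPowerSeries.coeff 0 f * MvPowerSeries.coeff 0 g := map_mul MvPowerSeries.constantCoeff
    rw [hmul, CycleIndexRing.coeff_truncation, h0, if_pos (Nat.zero_le _),
      h2, h3, mul_one, mul_one, sub_self, SymmetricSequence.coeff_cycleIndexSum,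
      GradedRep.coeff_cycleIndexSum, Finset.sum_eq_zero, smul_zero]
    intro σ _
    rw [gradedTrace_hookSequence hk, TupleFunction.boundariesTrace_eq_zero, map_zero, zero_mul]
    rw [Fintype.card_fin, h0]
    exact Nat.zero_le _
  · rw [coeff_cycleIndexSum_hookSequence hk h, zero_sub, neg_mul]

end
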